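/- There is a universal constant $C>0$ such that the following holds for every $n$. Let $K\subset\mathbb{R}^n$ be a centrally symmetric convex body (compact, convex, with non-empty interior, $K=-K$) in isotropic position, i.e. $\int_K\langle x,\theta\rangle^2dx$ is the same for all $\theta\in S^{n-1}$, and suppose $\mathrm{Vol}(K)=\mathrm{Vol}(D_n)$, where $D_n$ is the Euclidean unit ball. Then \[ L_K\le C\,\inf\{\mathcal{L}_k\,\mathrm{MR}_k(L)\;:\; K\subset L,\ L\in BP_k^n,\ k=1,\ldots,n-1\} \] (the infimum of the empty set being $+\infty$). Here: - the isotropic constant $L_K\ge 0$ of a centrally symmetric convex body $K$ is defined by $\int_{T(K)}\langle x,\theta\rangle^2dx=L_K^2$ for all $\theta\in S^{n-1}$, where $T$ is an invertible linear map such that $T(K)$ is in isotropic position and has volume $1$; and $\mathcal{L}_k$ is the maximal (the supremum of the) isotropic constant of centrally symmetric convex bodies in $\mathbb{R}^k$; - a (centrally symmetric) star body is a set $L=-L$ in $\mathbb{R}^n$ with $tL\subset L$ for $t\in[0,1]$ whose radial function $\rho_L(\theta)=\max\{r\ge0: r\theta\in L\}$ is defined and continuous on $S^{n-1}$; $\mathrm{MR}_k(L)=\left(\int_{S^{n-1}}\rho_L^k\,d\sigma\right)^{1/k}$,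 where $\sigma$ is the rotation invariant probability measure on $S^{n-1}$; - $BP_k^n$ is the class of $k$-Busemann–Petty bodies: star bodies $L$ in $\mathbb{R}^n$ for which there is a finite non-negative Borel measure $\mu$ on the Grassmannian $G(n,n-k)$ of $(n-k)$-dimensional subspaces with \[ \int_{S^{n-1}}f\,\rho_L^k\,d\sigma=\int_{G(n,n-k)}\int_{S^{n-1}\cap E}f\,d\sigma_E\,d\mu(E)\qquad\text{for all } f\in C(S^{n-1}), \] where $\sigma_E$ is the rotation invariant probability measure on $S^{n-1}\cap E$. -/

import Mathlib

open MeasureTheory Metric Set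
open scoped ENNReal NNReal Pointwise

noncomputable section

/-- A centrally symmetric convex body in `ℝⁿ`: a compact convex set with non-empty interior
such that `K = -K`. -/
structure IsSymmConvexBody {n : ℕ} (K : Set (EuclideanSpace ℝ (Fin n))) : Prop where
  convex : Convex ℝ K
  isCompact : IsCompact K
  interior_nonempty : (interior K).Nonempty
  neg_eq : -K = K

/-- `K` is in isotropic position: `∫_K ⟨x, θ⟩² dx` does not depend on `θ ∈ S^{n-1}`. -/
def IsIsotropic {n : ℕ} (K : Set (EuclideanSpace ℝ (Fin n))) : Prop :=
  ∃ a : ℝ, ∀ θ : EuclideanSpace ℝ (Fin n), ‖θ‖ = 1 → ∫ x in K, (inner ℝ x θ) ^ 2 = a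

/-- `c ≥ 0` is the isotropic constant of some isotropic position of volume `1` of `K`: for an
invertible linear `T`, the body `T(K)` has volume `1` and `∫_{T(K)} ⟨x, θ⟩² dx = c²` for all
`θ ∈ S^{n-1}`. -/
def IsIsotropicValue {n : ℕ} (K : Set (EuclideanSpace ℝ (Fin n))) (c : ℝ) : Prop :=
  0 ≤ c ∧ ∃ T : EuclideanSpace ℝ (Fin n) ≃ₗ[ℝ] EuclideanSpace ℝ (Fin n),
    volume (T '' K) = 1 ∧
      ∀ θ : EuclideanSpace ℝ (Fin n), ‖θ‖ = 1 → ∫ x in T '' K, (inner ℝ x θ) ^ 2 = c ^ 2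

/-- The isotropic constant `L_K`. For a centrally symmetric convex body in dimension at least `1`
the isotropic position of volume `1` exists and is unique up to rotations, so the set below has
exactly one element. -/
def isotropicConstant {n : ℕ} (K : Set (EuclideanSpace ℝ (Fin n))) : ℝ :=
  sSup {c : ℝ | IsIsotropicValue K c}

/-- The maximal isotropic constant `𝓛_k` of centrally symmetric convex bodies in `ℝᵏ`. -/
def maxIsotropicConstant (k : ℕ) : ℝ≥0∞ :=
  ⨆ (K : Set (EuclideanSpace ℝ (Fin k))) (_ : IsSymmConvexBody K),
    ENNReal.ofReal (isotropicConstant K)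

/-- The rotation invariant probability measure on the unit sphere of a (non-trivial)
finite-dimensional Euclidean space `F`: the normalized surface measure. -/
def sphereProb (F : Type*) [NormedAddCommGroup F] [InnerProductSpace ℝ F]
    [FiniteDimensional ℝ F] [MeasurableSpace F] [BorelSpace F] : Measure (sphere (0 : F) 1) :=
  ((volume : Measure F).toSphere univ)⁻¹ • (volume : Measure F).toSphere

/-- The radial function `ρ_L(θ) = max {r ≥ 0 | rθ ∈ L}`. -/
def radialFunction {n : ℕ} (L : Set (EuclideanSpace ℝ (Fin n)))
    (θ : EuclideanSpace ℝ (Fin n)) : ℝ :=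
  sSup {r : ℝ | 0 ≤ r ∧ r • θ ∈ L}

/-- A centrally symmetric star body: `tL ⊆ L` for `t ∈ [0, 1]`, the maximum that defines the
radial function exists in every direction, and the radial function is continuous on the sphere. -/
structure IsSymmStarBody {n : ℕ} (L : Set (EuclideanSpace ℝ (Fin n))) : Prop where
  smul_subset : ∀ t : ℝ, 0 ≤ t → t ≤ 1 → t • L ⊆ L
  isGreatest : ∀ θ : EuclideanSpace ℝ (Fin n), ‖θ‖ = 1 →
    IsGreatest {r : ℝ | 0 ≤ r ∧ r • θ ∈ L} (radialFunction L θ)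
  continuous_radial :
    Continuous fun θ : sphere (0 : EuclideanSpace ℝ (Fin n)) 1 => radialFunction L θ
  neg_eq : -L = L

/-- The `k`-th mean radius `MR_k(L) = (∫_{S^{n-1}} ρ_L^k dσ)^{1/k}`. -/
def meanRadius {n : ℕ} (k : ℕ) (L : Set (EuclideanSpace ℝ (Fin n))) : ℝ :=
  (∫ θ : sphere (0 : EuclideanSpace ℝ (Fin n)) 1, radialFunction L θ ^ k
    ∂(sphereProb (EuclideanSpace ℝ (Fin n)))) ^ (1 / (k : ℝ))

/-- The Grassmannian `G(n, m)` of `m`-dimensional linear subspaces of `ℝⁿ`. -/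
def Grassmann (n m : ℕ) : Type :=
  {E : Submodule ℝ (EuclideanSpace ℝ (Fin n)) // Module.finrank ℝ E = m}

/-- The usual topology of `G(n, m)`: subspaces are close when the orthogonal projections onto
them are close in operator norm. -/
instance instTopologicalSpaceGrassmann (n m : ℕ) : TopologicalSpace (Grassmann n m) :=
  TopologicalSpace.induced
    (fun E : Grassmann n m =>
      (E.1.starProjection : EuclideanSpace ℝ (Fin n) →L[ℝ] EuclideanSpace ℝ (Fin n)))
    inferInstance

/-- The Borel `σ`-algebra of `G(n, m)`. -/
instance instMeasurableSpaceGrassmann (n m : ℕ) : MeasurableSpace (Grassmann n m) :=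
  borel (Grassmann n m)

/-- The inclusion of the unit sphere `S^{n-1} ∩ E` of a subspace `E` into `S^{n-1}`. -/
def sphereIncl {n : ℕ} (E : Submodule ℝ (EuclideanSpace ℝ (Fin n))) (x : sphere (0 : E) 1) :
    sphere (0 : EuclideanSpace ℝ (Fin n)) 1 :=
  ⟨((x : E) : EuclideanSpace ℝ (Fin n)), by
    have h : ‖(x : E)‖ = 1 := mem_sphere_zero_iff_norm.1 x.2
    exact mem_sphere_zero_iff_norm.2 h⟩

/-- The `m`-dimensional spherical Radon transform
`R_m f (E) = ∫_{S^{n-1} ∩ E} f dσ_m` for `E ∈ G(n, m)`. -/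
def sphericalRadon {n : ℕ} (m : ℕ) (f : C(sphere (0 : EuclideanSpace ℝ (Fin n)) 1, ℝ))
    (E : Grassmann n m) : ℝ :=
  ∫ x : sphere (0 : E.1) 1, f (sphereIncl E.1 x) ∂(sphereProb E.1)

/-- `g = R_m^*(dμ)` for a function `g` on the sphere, regarded as the density of a measure with
respect to `σ`: `∫ f g dσ = ∫_{G(n,m)} R_m f dμ` for all continuous `f`. -/
def IsDualRadon {n : ℕ} (m : ℕ) (μ : Measure (Grassmann n m))
    (g : sphere (0 : EuclideanSpace ℝ (Fin n)) 1 → ℝ) : Prop :=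
  ∀ f : C(sphere (0 : EuclideanSpace ℝ (Fin n)) 1, ℝ),
    ∫ θ, f θ * g θ ∂(sphereProb (EuclideanSpace ℝ (Fin n))) = ∫ E, sphericalRadon m f E ∂μ

/-- `L` is a `k`-Busemann-Petty body in `ℝⁿ`: a star body with `ρ_L^k = R_{n-k}^*(dμ)` for some
non-negative (finite) Borel measure `μ` on `G(n, n-k)`. Used for `1 ≤ k < n`. -/
def IsBusemannPetty {n : ℕ} (k : ℕ) (L : Set (EuclideanSpace ℝ (Fin n))) : Prop :=
  IsSymmStarBody L ∧ ∃ μ : Measure (Grassmann n (n - k)), IsFiniteMeasure μ ∧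
    IsDualRadon (n - k) μ fun θ => radialFunction L θ ^ k

end

/-! Write `ρ_K` for the radial function of `K`, which is the reciprocal of its gauge. Since `K` has
the volume of the unit ball, `1 = ∫ ρ_K^n dσ`, and `K ⊆ L` bounds this by `∫ ρ_K^(n-k) ρ_L^k dσ`.
The Busemann-Petty property of `L`, tested on `ρ_K^(n-k)`, rewrites the last integral as an average
over `E` against `μ` of `Vol(K ∩ E) / Vol(D_(n-k))`. Tested on `1`, it shows that `μ` has total mass
`MR_k(L)^k`. The theorem thus reduces to a uniform bound on central sections of an isotropic body,
`isotropicConstant_pow_mul_section_le`: `L_K^k Vol(K ∩ E) Vol(K)^(k/n) ≤ (e³ 𝓛_k)^k Vol(K)`. The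
ball volumes are compared by log-convexity of Gamma.

For the section bound, let `g(y)` be the volume of the section of `K` parallel to `E` through `y ∈
Eᗮ ≅ ℝᵏ`. By Brunn-Minkowski `g` is even and log-concave, and isotropy of `K` makes its covariance a
multiple `a` of the identity. Ball's body for the moment of order `k + 1` turns `g` into a symmetric
convex body `B` in `ℝᵏ` (`IsSymmLogConcave.convex_ballBody`) whose second moments are exactly `a /
g(0)`. Comparing moments with an exponential density gives `Vol(B) ≤ e² Vol(K) / g(0)`. The
isotropic constant of `B` is at most `𝓛_k`, which bounds `a`, and hence `L_K`, in terms of `g(0) =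
Vol(K ∩ E)`. -/

/-! ### Brunn-Minkowski and Prékopa-Leindler inequalities -/

/-- The Brunn-Minkowski inequality on the line, for compact sets. -/
theorem IsCompact.volume_add_volume_le {A B C : Set ℝ} (hA : IsCompact A) (hB : IsCompact B)
    (hA0 : A.Nonempty) (hB0 : B.Nonempty) (hC : ∀ x ∈ A, ∀ y ∈ B, x + y ∈ C) :
    volume A + volume B ≤ volume C := by
  have ha := hA.isGreatest_sSup hA0
  have hb := hB.isLeast_sInf hB0
  set a := sSup A
  set b := sInf B
  have h1 : volume ((fun x => x + b) '' A) = volume A := by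
    rw [image_add_right]; exact measure_preimage_add_right _ _ _
  have h2 : volume ((fun x => a + x) '' B) = volume B := by
    rw [image_add_left]; exact measure_preimage_add _ _ _
  -- The translates `A + min B` and `max A + B` lie on opposite sides of `a + b`, so they share at
  -- most that point, and both are contained in `C`.
  have hd : AEDisjoint volume ((fun x => x + b) '' A) ((fun x => a + x) '' B) := by
    refine measure_mono_null (t := {a + b}) ?_ (by simp)
    rintro z ⟨⟨x, hx, rfl⟩, ⟨y, hy, hxy⟩⟩
    have := ha.2 hx
    have := hb.2 hy
    simp only [mem_singleton_iff] at *
    linarith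
  rw [← h1, ← h2, ← measure_union₀ _ hd]
  · refine measure_mono ?_
    rintro z (⟨x, hx, rfl⟩ | ⟨y, hy, rfl⟩)
    · exact hC _ hx _ hb.1
    · exact hC _ ha.1 _ hy
  · exact (hB.image (by fun_prop)).measurableSet.nullMeasurableSet

/-- The Brunn-Minkowski inequality on the line. -/
theorem volume_add_volume_le_of_add_subset {A B C : Set ℝ} (hA : MeasurableSet A)
    (hB : MeasurableSet B) (hA0 : A.Nonempty) (hB0 : B.Nonempty)
    (hC : ∀ x ∈ A, ∀ y ∈ B, x + y ∈ C) : volume A + volume B ≤ volume C := by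
  obtain ⟨x₀, hx₀⟩ := hA0
  obtain ⟨y₀, hy₀⟩ := hB0
  rw [hA.measure_eq_iSup_isCompact, hB.measure_eq_iSup_isCompact]
  refine ENNReal.biSup_add_biSup_le' (p := fun K => K ⊆ A) (q := fun K => K ⊆ B)
    ⟨{x₀}, by simpa⟩ ⟨{y₀}, by simpa⟩ ?_
  intro K hK K' hK'
  -- A non-compact set contributes `0` to its supremum, and a compact one may be empty. Inserting
  -- `x₀` and `y₀` restores non-emptiness without leaving `A` and `B`.
  by_cases hc : IsCompact K <;> by_cases hc' : IsCompact K' <;> simp only [hc, hc', iSup_pos,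
    bot_eq_zero', add_zero, zero_add, iSup_neg, not_false_eq_true]
  · refine le_trans (add_le_add (measure_mono (subset_insert x₀ K))
      (measure_mono (subset_insert y₀ K'))) ?_
    refine (hc.insert x₀).volume_add_volume_le (hc'.insert y₀) ⟨x₀, by simp⟩ ⟨y₀, by simp⟩ ?_
    intro x hx y hy
    exact hC _ (insert_subset hx₀ hK hx) _ (insert_subset hy₀ hK' hy)
  · refine le_trans (measure_mono (subset_insert x₀ K)) (le_trans (self_le_add_right _ (volume {y₀})) ?_)
    refine (hc.insert x₀).volume_add_volume_le (isCompact_singleton) ⟨x₀, by simp⟩ ⟨y₀, by simp⟩ ?_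
    intro x hx y hy
    exact hC _ (insert_subset hx₀ hK hx) _ (by simp at hy; simpa [hy])
  · refine le_trans (measure_mono (subset_insert y₀ K')) (le_trans (self_le_add_left _ (volume {x₀})) ?_)
    refine (isCompact_singleton).volume_add_volume_le (hc'.insert y₀) ⟨x₀, by simp⟩ ⟨y₀, by simp⟩ ?_
    intro x hx y hy
    exact hC _ (by simp at hx; simpa [hx]) _ (insert_subset hy₀ hK' hy)
  · simp

/-- Layer cake formula for functions bounded by `1`. -/
theorem lintegral_eq_lintegral_meas_lt_of_le_one {f : ℝ → ℝ≥0∞} (hf : Measurable f)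
    (hf1 : ∀ x, f x ≤ 1) :
    ∫⁻ x, f x = ∫⁻ t in Ioo (0 : ℝ) 1, volume {x | ENNReal.ofReal t < f x} := by
  have hfin : ∀ x, f x ≠ ∞ := fun x => ne_top_of_le_ne_top ENNReal.one_ne_top (hf1 x)
  have h := lintegral_eq_lintegral_meas_lt (f := fun x => (f x).toReal) volume
    (Filter.Eventually.of_forall fun x => ENNReal.toReal_nonneg) hf.ennreal_toReal.aemeasurable
  simp only [ENNReal.ofReal_toReal (hfin _)] at h
  rw [h, ← Ioo_union_Ici_eq_Ioi (zero_lt_one' ℝ), lintegral_union measurableSet_Ici]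
  · have : ∫⁻ t in Ici (1 : ℝ), volume {x | t < (f x).toReal} = 0 := by
      rw [setLIntegral_congr_fun (g := fun _ => 0) measurableSet_Ici]
      · simp
      · intro t ht
        have : {x | t < (f x).toReal} = ∅ := by
          ext x
          simp only [mem_ofPred_eq, mem_empty_iff_false, iff_false, not_lt]
          refine le_trans ?_ (mem_Ici.1 ht)
          simpa using ENNReal.toReal_mono ENNReal.one_ne_top (hf1 x)
        simp [this]
    rw [this, add_zero]
    refine setLIntegral_congr_fun measurableSet_Ioo fun t ht => ?_
    congr 1
    ext x
    simp [ENNReal.ofReal_lt_iff_lt_toReal ht.1.le (hfin x)]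
  · exact Set.disjoint_left.2 fun x hx hx' => absurd hx.2 (not_lt.2 hx')

theorem ENNReal.rpow_mul_rpow_le_add {a b : ℝ} (ha : 0 < a) (hb : 0 < b) (hab : a + b = 1)
    (x y : ℝ≥0∞) : x ^ a * y ^ b ≤ ENNReal.ofReal a * x + ENNReal.ofReal b * y := by
  rcases eq_or_ne x ∞ with rfl | hx
  · simp [ENNReal.mul_top, ha]
  rcases eq_or_ne y ∞ with rfl | hy
  · simp [ENNReal.mul_top, hb]
  lift x to ℝ≥0 using hx
  lift y to ℝ≥0 using hy
  have := NNReal.geom_mean_le_arith_mean2_weighted a.toNNReal b.toNNReal x y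
    (by rw [← Real.toNNReal_add ha.le hb.le, hab, Real.toNNReal_one])
  rw [Real.coe_toNNReal _ ha.le, Real.coe_toNNReal _ hb.le] at this
  rw [← ENNReal.coe_rpow_of_nonneg _ ha.le, ← ENNReal.coe_rpow_of_nonneg _ hb.le,
    ← ENNReal.coe_mul]
  refine (ENNReal.coe_le_coe.2 this).trans_eq ?_
  simp [ENNReal.ofReal]

/-- The Prékopa-Leindler inequality on the line, normalized functions. -/
theorem prekopa_leindler_real_of_iSup_eq_one {a b : ℝ} (ha : 0 < a) (hb : 0 < b)
    (hab : a + b = 1) {f g h : ℝ → ℝ≥0∞} (hf : Measurable f) (hg : Measurable g)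
    (hh : Measurable h) (hf1 : ⨆ x, f x = 1) (hg1 : ⨆ x, g x = 1)
    (H : ∀ x y, f x ^ a * g y ^ b ≤ h (a * x + b * y)) :
    (∫⁻ x, f x) ^ a * (∫⁻ x, g x) ^ b ≤ ∫⁻ x, h x := by
  refine (ENNReal.rpow_mul_rpow_le_add ha hb hab _ _).trans ?_
  -- After truncating `h` at `1`, only levels `t ∈ (0, 1)` remain. At these levels the superlevel
  -- sets of `f` and `g` are non-empty, because both suprema are `1`, so Brunn-Minkowski on the line
  -- applies to them.
  refine le_trans ?_ (lintegral_mono fun x => min_le_left (h x) 1)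
  rw [lintegral_eq_lintegral_meas_lt_of_le_one hf fun x => hf1 ▸ le_iSup f x,
    lintegral_eq_lintegral_meas_lt_of_le_one hg fun x => hg1 ▸ le_iSup g x,
    lintegral_eq_lintegral_meas_lt_of_le_one (hh.min measurable_const) fun x => min_le_right _ _]
  have hm : ∀ f : ℝ → ℝ≥0∞, Measurable fun t : ℝ => volume {x | ENNReal.ofReal t < f x} := by
    intro f
    refine Antitone.measurable fun s t hst => measure_mono fun x hx => ?_
    exact (ENNReal.ofReal_le_ofReal hst).trans_lt hx
  rw [← lintegral_const_mul _ (hm f), ← lintegral_const_mul _ (hm g),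
    ← lintegral_add_left ((hm f).const_mul _)]
  refine setLIntegral_mono (hm _) fun t ht => ?_
  have key : ∀ f : ℝ → ℝ≥0∞, ⨆ x, f x = 1 → {x | ENNReal.ofReal t < f x}.Nonempty := by
    intro f hf
    have : ENNReal.ofReal t < ⨆ x, f x := by
      rw [hf, ← ENNReal.ofReal_one]; exact (ENNReal.ofReal_lt_ofReal_iff one_pos).2 ht.2
    obtain ⟨x, hx⟩ := lt_iSup_iff.1 this
    exact ⟨x, hx⟩
  have e : ∀ (c : ℝ), 0 < c → ∀ s : Set ℝ, ENNReal.ofReal c * volume s = volume (c • s) := by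
    intro c hc s
    rw [Measure.addHaar_smul]
    simp [abs_of_pos hc]
  rw [e a ha, e b hb]
  refine volume_add_volume_le_of_add_subset ((measurableSet_lt measurable_const hf).const_smul_of_ne_zero ha.ne')
    ((measurableSet_lt measurable_const hg).const_smul_of_ne_zero hb.ne') ((key f hf1).smul_set)
    ((key g hg1).smul_set) ?_
  rintro _ ⟨x, hx, rfl⟩ _ ⟨y, hy, rfl⟩
  simp only [mem_ofPred_eq, smul_eq_mul] at hx hy ⊢
  rw [lt_min_iff]
  constructor
  · refine lt_of_lt_of_le ?_ (H x y)
    have ht0 : ENNReal.ofReal t ≠ 0 := by simpa using ht.1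
    calc ENNReal.ofReal t = ENNReal.ofReal t ^ a * ENNReal.ofReal t ^ b := by
          rw [← ENNReal.rpow_add _ _ ht0 ENNReal.ofReal_ne_top, hab, ENNReal.rpow_one]
      _ < f x ^ a * g y ^ b := by
          refine ENNReal.mul_lt_mul (ENNReal.rpow_lt_rpow hx ha) (ENNReal.rpow_lt_rpow hy hb)
  · rw [← ENNReal.ofReal_one]; exact (ENNReal.ofReal_lt_ofReal_iff one_pos).2 ht.2

/-- The Prékopa-Leindler inequality on the line, bounded functions. -/
theorem prekopa_leindler_real_of_bounded {a b : ℝ} (ha : 0 < a) (hb : 0 < b)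
    (hab : a + b = 1) {f g h : ℝ → ℝ≥0∞} (hf : Measurable f) (hg : Measurable g)
    (hh : Measurable h) (hf1 : ⨆ x, f x ≠ ∞) (hg1 : ⨆ x, g x ≠ ∞)
    (H : ∀ x y, f x ^ a * g y ^ b ≤ h (a * x + b * y)) :
    (∫⁻ x, f x) ^ a * (∫⁻ x, g x) ^ b ≤ ∫⁻ x, h x := by
  set F := ⨆ x, f x with hF
  set G := ⨆ x, g x with hG
  rcases eq_or_ne F 0 with hF0 | hF0
  · have : ∀ x, f x = 0 := fun x => by simpa using (le_iSup f x).trans_eq hF0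
    simp [this, ENNReal.zero_rpow_of_pos ha]
  rcases eq_or_ne G 0 with hG0 | hG0
  · have : ∀ x, g x = 0 := fun x => by simpa using (le_iSup g x).trans_eq hG0
    simp [this, ENNReal.zero_rpow_of_pos hb]
  have := prekopa_leindler_real_of_iSup_eq_one ha hb hab (f := fun x => F⁻¹ * f x)
    (g := fun x => G⁻¹ * g x) (h := fun x => (F⁻¹ ^ a * G⁻¹ ^ b) * h x)
    (hf.const_mul _) (hg.const_mul _) (hh.const_mul _)
    (by rw [← ENNReal.mul_iSup, ENNReal.inv_mul_cancel hF0 hf1])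
    (by rw [← ENNReal.mul_iSup, ENNReal.inv_mul_cancel hG0 hg1]) (fun x y => by
      rw [ENNReal.mul_rpow_of_nonneg _ _ ha.le, ENNReal.mul_rpow_of_nonneg _ _ hb.le]
      calc _ = (F⁻¹ ^ a * G⁻¹ ^ b) * (f x ^ a * g y ^ b) := by ring
        _ ≤ _ := by gcongr; exact H x y)
  rw [lintegral_const_mul _ hf, lintegral_const_mul _ hg, lintegral_const_mul _ hh,
    ENNReal.mul_rpow_of_nonneg _ _ ha.le, ENNReal.mul_rpow_of_nonneg _ _ hb.le] at this
  have e : F⁻¹ ^ a * (∫⁻ x, f x) ^ a * (G⁻¹ ^ b * (∫⁻ x, g x) ^ b) =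
    (F⁻¹ ^ a * G⁻¹ ^ b) * ((∫⁻ x, f x) ^ a * (∫⁻ x, g x) ^ b) := by ring
  rw [e] at this
  refine (ENNReal.mul_le_mul_iff_right ?_ ?_).1 this
  · refine mul_ne_zero ?_ ?_
    · exact (ENNReal.rpow_pos (ENNReal.inv_pos.2 hf1) (ENNReal.inv_ne_top.2 hF0)).ne'
    · exact (ENNReal.rpow_pos (ENNReal.inv_pos.2 hg1) (ENNReal.inv_ne_top.2 hG0)).ne'
  · refine ENNReal.mul_ne_top ?_ ?_
    · exact ENNReal.rpow_ne_top_of_nonneg ha.le (ENNReal.inv_ne_top.2 hF0)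
    · exact ENNReal.rpow_ne_top_of_nonneg hb.le (ENNReal.inv_ne_top.2 hG0)

/-- The Prékopa-Leindler inequality on the line. -/
theorem prekopa_leindler_real {a b : ℝ} (ha : 0 < a) (hb : 0 < b)
    (hab : a + b = 1) {f g h : ℝ → ℝ≥0∞} (hf : Measurable f) (hg : Measurable g)
    (hh : Measurable h) (H : ∀ x y, f x ^ a * g y ^ b ≤ h (a * x + b * y)) :
    (∫⁻ x, f x) ^ a * (∫⁻ x, g x) ^ b ≤ ∫⁻ x, h x := by
  have key : ∀ f : ℝ → ℝ≥0∞, Measurable f →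
      ∫⁻ x, f x = ⨆ N : ℕ, ∫⁻ x, min (f x) N := by
    intro f hf
    rw [← lintegral_iSup (fun N => hf.min measurable_const)]
    · congr 1
      ext x
      simp only [← inf_iSup_eq, ENNReal.iSup_natCast, le_top, inf_of_le_left]
    · intro N M hNM x
      exact min_le_min le_rfl (by exact_mod_cast hNM)
  have kmono : ∀ f : ℝ → ℝ≥0∞, Monotone fun N : ℕ => ∫⁻ x, min (f x) N := by
    intro f N M hNM
    exact lintegral_mono fun x => min_le_min le_rfl (by exact_mod_cast hNM)
  have kpow : ∀ (c : ℝ), 0 < c → ∀ u : ℕ → ℝ≥0∞, (⨆ N, u N) ^ c = ⨆ N, u N ^ c := by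
    intro c hc u
    exact (ENNReal.orderIsoRpow c hc).map_iSup u
  rw [key f hf, key g hg, kpow a ha, kpow b hb, ENNReal.iSup_mul]
  refine iSup_le fun N => ?_
  rw [ENNReal.mul_iSup]
  refine iSup_le fun M => ?_
  have := prekopa_leindler_real_of_bounded ha hb hab (f := fun x => min (f x) (N ⊔ M : ℕ))
    (g := fun x => min (g x) (N ⊔ M : ℕ)) (hf.min measurable_const) (hg.min measurable_const) hh
    (ne_top_of_le_ne_top (ENNReal.natCast_ne_top (N ⊔ M)) (iSup_le fun x => min_le_right _ _))
    (ne_top_of_le_ne_top (ENNReal.natCast_ne_top (N ⊔ M)) (iSup_le fun x => min_le_right _ _))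
    (fun x y => le_trans (mul_le_mul' (ENNReal.rpow_le_rpow (min_le_left _ _) ha.le)
      (ENNReal.rpow_le_rpow (min_le_left _ _) hb.le)) (H x y))
  refine le_trans (mul_le_mul' (ENNReal.rpow_le_rpow ?_ ha.le) (ENNReal.rpow_le_rpow ?_ hb.le)) this
  · exact kmono f le_sup_left
  · exact kmono g le_sup_right

/-- The **Prékopa-Leindler inequality**. -/
theorem prekopa_leindler {a b : ℝ} (ha : 0 < a) (hb : 0 < b) (hab : a + b = 1) :
    ∀ (m : ℕ) {f g h : (Fin m → ℝ) → ℝ≥0∞}, Measurable f → Measurable g →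
    Measurable h → (∀ x y, f x ^ a * g y ^ b ≤ h (a • x + b • y)) →
    (∫⁻ x, f x) ^ a * (∫⁻ x, g x) ^ b ≤ ∫⁻ x, h x
  | 0, f, g, h, _, _, _, H => by
    have e : ∀ f : (Fin 0 → ℝ) → ℝ≥0∞, ∫⁻ x, f x = f 0 := by
      intro f
      rw [lintegral_unique, Measure.volume_pi_eq_dirac 0]
      rw [measure_univ, mul_one]
      exact congrArg f (Subsingleton.elim _ _)
    rw [e, e, e]
    simpa using H 0 0
  | m + 1, f, g, h, hf, hg, hh, H => by
    have e := volume_preserving_piFinSuccAbove (fun _ : Fin (m + 1) => ℝ) 0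
    have key : ∀ f : (Fin (m + 1) → ℝ) → ℝ≥0∞, Measurable f →
        ∫⁻ x, f x = ∫⁻ t : ℝ, ∫⁻ v : Fin m → ℝ, f (Fin.cons t v) := by
      intro f hf
      rw [← e.symm.lintegral_comp hf, Measure.volume_eq_prod, lintegral_prod]
      · simp [MeasurableEquiv.piFinSuccAbove, Fin.insertNthEquiv]
      · exact (hf.comp (MeasurableEquiv.measurable _)).aemeasurable
    have hc : Measurable fun p : ℝ × (Fin m → ℝ) => (Fin.cons p.1 p.2 : Fin (m + 1) → ℝ) := by
      refine measurable_pi_iff.2 fun i => ?_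
      refine Fin.cases ?_ (fun j => ?_) i <;> simp only [Fin.cons_zero, Fin.cons_succ] <;> fun_prop
    have hc' : ∀ t : ℝ, Measurable fun v : Fin m → ℝ => (Fin.cons t v : Fin (m + 1) → ℝ) :=
      fun t => hc.comp measurable_prodMk_left
    have hmeas : ∀ f : (Fin (m + 1) → ℝ) → ℝ≥0∞, Measurable f →
        Measurable fun t : ℝ => ∫⁻ v : Fin m → ℝ, f (Fin.cons t v) := by
      intro f hf
      exact Measurable.lintegral_prod_right' (f := fun p : ℝ × (Fin m → ℝ) => f (Fin.cons p.1 p.2))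
        (hf.comp hc)
    rw [key f hf, key g hg, key h hh]
    -- Tensorisation: by the inductive hypothesis the fibre integrals satisfy the one-dimensional
    -- assumption.
    refine prekopa_leindler_real ha hb hab (hmeas f hf) (hmeas g hg) (hmeas h hh) fun s t => ?_
    refine prekopa_leindler ha hb hab m (hf.comp (hc' s)) (hg.comp (hc' t)) (hh.comp (hc' _)) ?_
    intro x y
    refine (H (Fin.cons s x) (Fin.cons t y)).trans_eq ?_
    congr 1
    ext i
    refine Fin.cases ?_ (fun j => ?_) i <;> simp

/-- The multiplicative form of the Brunn-Minkowski inequality. -/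
theorem volume_rpow_mul_volume_rpow_le {Y : Type*} [NormedAddCommGroup Y] [InnerProductSpace ℝ Y]
    [FiniteDimensional ℝ Y] [MeasurableSpace Y] [BorelSpace Y] {a b : ℝ} (ha : 0 < a) (hb : 0 < b)
    (hab : a + b = 1) {A B C : Set Y} (hA : MeasurableSet A) (hB : MeasurableSet B)
    (hC : MeasurableSet C) (H : ∀ x ∈ A, ∀ y ∈ B, a • x + b • y ∈ C) :
    volume A ^ a * volume B ^ b ≤ volume C := by
  let e := (stdOrthonormalBasis ℝ Y).repr.symm
  have he : MeasurePreserving (fun v : Fin (Module.finrank ℝ Y) → ℝ => e (WithLp.toLp 2 v)) :=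
    e.measurePreserving.comp (PiLp.volume_preserving_toLp _)
  have key : ∀ S : Set Y, MeasurableSet S → volume S =
      ∫⁻ v : Fin (Module.finrank ℝ Y) → ℝ, S.indicator 1 (e (WithLp.toLp 2 v)) := by
    intro S hS
    rw [he.lintegral_comp (f := S.indicator 1) (measurable_one.indicator hS)]
    simp [lintegral_indicator_one hS]
  have hmeas : ∀ S : Set Y, MeasurableSet S → Measurable fun v : Fin (Module.finrank ℝ Y) → ℝ =>
      S.indicator (1 : Y → ℝ≥0∞) (e (WithLp.toLp 2 v)) :=
    fun S hS => (measurable_one.indicator hS).comp he.measurable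
  rw [key A hA, key B hB, key C hC]
  refine prekopa_leindler ha hb hab _ (hmeas A hA) (hmeas B hB) (hmeas C hC) fun x y => ?_
  by_cases hx : e (WithLp.toLp 2 x) ∈ A
  · by_cases hy : e (WithLp.toLp 2 y) ∈ B
    · simp [hx, hy, indicator_of_mem (H _ hx _ hy)]
    · simp [hy, hb]
  · simp [hx, ha]

/-! ### Ball's inequality by one-dimensional transport -/

/-- The quantile function of a continuous positive density on an interval is differentiable. -/
theorem exists_quantile {φ : ℝ → ℝ} {s₀ : ℝ} (hs₀ : 0 < s₀) (hcont : ContinuousOn φ (Ioo 0 s₀))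
    (hpos : ∀ s ∈ Ioo 0 s₀, 0 < φ s) (hint : IntegrableOn φ (Ioo 0 s₀)) :
    ∃ S : ℝ → ℝ, ∀ τ ∈ Ioo (0 : ℝ) 1, S τ ∈ Ioo 0 s₀ ∧
      HasDerivAt S ((∫ s in Ioo 0 s₀, φ s) / φ (S τ)) τ := by
  have hint' : IntervalIntegrable φ volume 0 s₀ := by
    rw [intervalIntegrable_iff_integrableOn_Ioo_of_le hs₀.le]; exact hint
  set A := ∫ s in Ioo 0 s₀, φ s with hA
  have hA' : A = ∫ s in (0 : ℝ)..s₀, φ s := by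
    rw [intervalIntegral.integral_of_le hs₀.le, integral_Ioc_eq_integral_Ioo]
  have hApos : 0 < A := by
    rw [hA']
    exact intervalIntegral.intervalIntegral_pos_of_pos_on hint' hpos hs₀
  set F : ℝ → ℝ := fun s => (∫ u in (0 : ℝ)..s, φ u) / A with hF
  have hFcont : ContinuousOn F (Icc 0 s₀) := by
    refine ContinuousOn.div_const ?_ _
    have := intervalIntegral.continuousOn_primitive_interval (μ := volume) (f := φ) (a := 0) (b := s₀)
      (by rw [uIcc_of_le hs₀.le, integrableOn_Icc_iff_integrableOn_Ioo]; exact hint)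
    rwa [uIcc_of_le hs₀.le] at this
  have hFderiv : ∀ s ∈ Ioo 0 s₀, HasDerivAt F (φ s / A) s := by
    intro s hs
    refine HasDerivAt.div_const ?_ _
    refine intervalIntegral.integral_hasDerivAt_right ?_ ?_ (hcont.continuousAt (Ioo_mem_nhds hs.1 hs.2))
    · exact hint'.mono_set (by
        rw [uIcc_of_le hs₀.le, uIcc_of_le hs.1.le]; exact Icc_subset_Icc le_rfl hs.2.le)
    · exact hcont.stronglyMeasurableAtFilter isOpen_Ioo s hs
  have hFmono : StrictMonoOn F (Icc 0 s₀) := by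
    refine strictMonoOn_of_deriv_pos (convex_Icc _ _) hFcont fun s hs => ?_
    rw [interior_Icc] at hs
    rw [(hFderiv s hs).deriv]
    exact div_pos (hpos s hs) hApos
  have hF0 : F 0 = 0 := by simp [hF]
  have hF1 : F s₀ = 1 := by simp only [hF, ← hA']; exact div_self hApos.ne'
  have hsurj := intermediate_value_Ioo hs₀.le hFcont
  rw [hF0, hF1] at hsurj
  have hmem : ∀ s ∈ Ioo 0 s₀, F s ∈ Ioo (0 : ℝ) 1 := by
    intro s hs
    rw [← hF0, ← hF1]
    exact ⟨hFmono (left_mem_Icc.2 hs₀.le) (Ioo_subset_Icc_self hs) hs.1,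
      hFmono (Ioo_subset_Icc_self hs) (right_mem_Icc.2 hs₀.le) hs.2⟩
  -- `S` inverts the normalised primitive `F`. It is strictly increasing with an open interval as
  -- image, hence continuous, and the inverse function rule gives its derivative.
  choose! S hS hFS using fun τ (hτ : τ ∈ Ioo (0 : ℝ) 1) => hsurj hτ
  have hSmono : StrictMonoOn S (Ioo 0 1) := by
    intro x hx y hy hxy
    rw [← hFmono.lt_iff_lt (Ioo_subset_Icc_self (hS x hx)) (Ioo_subset_Icc_self (hS y hy)),
      hFS x hx, hFS y hy]
    exact hxy
  have hSimage : S '' Ioo 0 1 = Ioo 0 s₀ := by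
    refine subset_antisymm (image_subset_iff.2 hS) fun s hs => ⟨F s, hmem s hs, ?_⟩
    exact hFmono.injOn (Ioo_subset_Icc_self (hS _ (hmem s hs))) (Ioo_subset_Icc_self hs)
      (hFS _ (hmem s hs))
  refine ⟨S, fun τ hτ => ⟨hS τ hτ, ?_⟩⟩
  have hc : ContinuousAt S τ := by
    refine hSmono.continuousAt_of_image_mem_nhds (Ioo_mem_nhds hτ.1 hτ.2) ?_
    rw [hSimage]
    exact Ioo_mem_nhds (hS τ hτ).1 (hS τ hτ).2
  have := HasDerivAt.of_local_left_inverse hc (hFderiv _ (hS τ hτ))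
    (div_pos (hpos _ (hS τ hτ)) hApos).ne'
    (by filter_upwards [Ioo_mem_nhds hτ.1 hτ.2] with y hy using hFS y hy)
  rwa [inv_div] at this

/-- The arithmetic-geometric mean inequality is used twice: on `s, t`, giving `s^α t^β ≤ r`, and on
the reciprocals of `u = s^(q+1) x` and `v = t^(q+1) y`. This is the pointwise lower bound for the
integrand after the change of variable below. -/
theorem le_transport_integrand {q : ℕ} {s t r α β x y z c : ℝ} (hs : 0 < s) (ht : 0 < t) (hr : 0 < r)
    (hα : 0 < α) (hβ : 0 < β) (hαβ : α + β = 1) (hrαβ : r = α * s + β * t) (hx : 0 < x) (hy : 0 < y)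
    (hxyz : x ^ α * y ^ β ≤ z) (hc : 0 ≤ c) :
    c ≤ r ^ (q + 1) * z * (α * (c / (s ^ (q + 1) * x)) + β * (c / (t ^ (q + 1) * y))) := by
  set u := s ^ (q + 1) * x
  set v := t ^ (q + 1) * y
  have hu : 0 < u := by positivity
  have hv : 0 < v := by positivity
  have huv : u ^ α * v ^ β ≤ r ^ (q + 1) * z := by
    calc u ^ α * v ^ β = (s ^ α * t ^ β) ^ (q + 1) * (x ^ α * y ^ β) := by
          rw [Real.mul_rpow (by positivity) hx.le, Real.mul_rpow (by positivity) hy.le, mul_pow,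
            ← Real.rpow_natCast, ← Real.rpow_natCast, ← Real.rpow_natCast, ← Real.rpow_natCast,
            ← Real.rpow_mul hs.le, ← Real.rpow_mul ht.le, ← Real.rpow_mul hs.le,
            ← Real.rpow_mul ht.le, mul_comm ((q + 1 : ℕ) : ℝ) α, mul_comm ((q + 1 : ℕ) : ℝ) β]
          ring
      _ ≤ r ^ (q + 1) * z := by
          have := Real.geom_mean_le_arith_mean2_weighted hα.le hβ.le hs.le ht.le hαβ
          rw [← hrαβ] at this
          gcongr
  have h2 : (u ^ α * v ^ β)⁻¹ ≤ α * u⁻¹ + β * v⁻¹ := by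
    have := Real.geom_mean_le_arith_mean2_weighted hα.le hβ.le (inv_pos.2 hu).le (inv_pos.2 hv).le hαβ
    rwa [Real.inv_rpow hu.le, Real.inv_rpow hv.le, ← mul_inv] at this
  have hw : 0 < u ^ α * v ^ β := by positivity
  calc c = (u ^ α * v ^ β) * (c * (u ^ α * v ^ β)⁻¹) := by field_simp
    _ ≤ r ^ (q + 1) * z * (c * (α * u⁻¹ + β * v⁻¹)) := by
        have : 0 ≤ z := le_trans (by positivity) hxyz
        gcongr
    _ = _ := by simp only [div_eq_mul_inv]; ring

/-- Ball's inequality for the integrals `∫ r ^ q * h r dr` of functions related by harmonic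
means. -/
theorem le_lintegral_pow_mul_of_harmonic_mean {q : ℕ} {h₁ h₂ h₃ : ℝ → ℝ} {s₀ t₀ l c : ℝ}
    (hs₀ : 0 < s₀) (ht₀ : 0 < t₀) (hl : l ∈ Ioo (0 : ℝ) 1) (hc : 0 ≤ c)
    (hcont₁ : ContinuousOn h₁ (Ioo 0 s₀)) (hcont₂ : ContinuousOn h₂ (Ioo 0 t₀))
    (hpos₁ : ∀ s ∈ Ioo 0 s₀, 0 < h₁ s) (hpos₂ : ∀ t ∈ Ioo 0 t₀, 0 < h₂ t)
    (hint₁ : IntegrableOn (fun s => s ^ q * h₁ s) (Ioo 0 s₀))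
    (hint₂ : IntegrableOn (fun t => t ^ q * h₂ t) (Ioo 0 t₀))
    (hc₁ : c ≤ ∫ s in Ioo 0 s₀, s ^ q * h₁ s) (hc₂ : c ≤ ∫ t in Ioo 0 t₀, t ^ q * h₂ t)
    (H : ∀ s ∈ Ioo 0 s₀, ∀ t ∈ Ioo 0 t₀, ∀ r, 0 < r → r⁻¹ = (1 - l) / s + l / t →
      h₁ s ^ ((1 - l) * r / s) * h₂ t ^ (l * r / t) ≤ h₃ r) :
    ENNReal.ofReal c ≤ ∫⁻ r in Ioi (0 : ℝ), ENNReal.ofReal (r ^ q * h₃ r) := by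
  obtain ⟨S, hS⟩ := exists_quantile hs₀ (φ := fun s => s ^ q * h₁ s) (by fun_prop)
    (fun s hs => mul_pos (pow_pos hs.1 _) (hpos₁ s hs)) hint₁
  obtain ⟨T, hT⟩ := exists_quantile ht₀ (φ := fun s => s ^ q * h₂ s) (by fun_prop)
    (fun s hs => mul_pos (pow_pos hs.1 _) (hpos₂ s hs)) hint₂
  set A := ∫ s in Ioo 0 s₀, s ^ q * h₁ s
  set B := ∫ s in Ioo 0 t₀, s ^ q * h₂ s
  obtain ⟨hl0, hl1⟩ := hl
  have hl1' : 0 < 1 - l := by linarith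
  set S' : ℝ → ℝ := fun τ => A / (S τ ^ q * h₁ (S τ))
  set T' : ℝ → ℝ := fun τ => B / (T τ ^ q * h₂ (T τ))
  -- `R` is the harmonic mean of the two quantile functions. Substituting `r = R τ` in the integral
  -- of `r ^ q * h₃ r` leaves an integral over `(0, 1)` whose integrand is at least `c` pointwise.
  set R : ℝ → ℝ := fun τ => ((1 - l) / S τ + l / T τ)⁻¹ with hR
  set R' : ℝ → ℝ := fun τ => R τ ^ 2 * ((1 - l) * S' τ / S τ ^ 2 + l * T' τ / T τ ^ 2) with hR'
  have hRpos : ∀ τ ∈ Ioo (0 : ℝ) 1, 0 < R τ := by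
    intro τ hτ
    have := (hS τ hτ).1.1
    have := (hT τ hτ).1.1
    positivity
  have hderiv : ∀ τ ∈ Ioo (0 : ℝ) 1, HasDerivAt R (R' τ) τ := by
    intro τ hτ
    have h1 := (hS τ hτ).1.1
    have h2 := (hT τ hτ).1.1
    have h3 : (1 - l) / S τ + l / T τ ≠ 0 := by positivity
    have := ((((hS τ hτ).2.inv h1.ne').const_mul (1 - l)).add
      (((hT τ hτ).2.inv h2.ne').const_mul l)).inv (by simpa [div_eq_mul_inv] using h3)
    convert! this using 1
    simp only [hR', hR, S', T', Pi.add_apply, Pi.inv_apply]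
    simp only [div_eq_mul_inv]
    rw [inv_pow]
    ring
  have hpw : ∀ τ ∈ Ioo (0 : ℝ) 1, c ≤ R' τ * (R τ ^ q * h₃ (R τ)) := by
    intro τ hτ
    have h1 := (hS τ hτ).1.1
    have h2 := (hT τ hτ).1.1
    have hr := hRpos τ hτ
    have hx := hpos₁ _ (hS τ hτ).1
    have hy := hpos₂ _ (hT τ hτ).1
    have hinv : (R τ)⁻¹ = (1 - l) / S τ + l / T τ := by simp [hR]
    have hsum : (1 - l) * R τ / S τ + l * R τ / T τ = 1 := by
      have : R τ * (R τ)⁻¹ = 1 := mul_inv_cancel₀ hr.ne'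
      rw [hinv] at this
      exact Eq.trans (by ring) this
    have hz := H _ (hS τ hτ).1 _ (hT τ hτ).1 (R τ) hr hinv
    have hz0 : 0 ≤ h₃ (R τ) := le_trans (by positivity) hz
    -- These weights sum to `1` and make `R τ` also the arithmetic mean `α * S τ + β * T τ`.
    have := le_transport_integrand (q := q) h1 h2 hr (α := (1 - l) * R τ / S τ)
      (β := l * R τ / T τ) (by positivity) (by positivity) hsum (by field_simp; ring) hx hy hz hc
    refine this.trans ?_
    calc _ ≤ R τ ^ (q + 1) * h₃ (R τ) * ((1 - l) * R τ / S τ * (A / (S τ ^ (q + 1) * h₁ (S τ))) +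
          l * R τ / T τ * (B / (T τ ^ (q + 1) * h₂ (T τ)))) := by
            gcongr
      _ = _ := by
          simp only [hR', S', T', pow_succ]
          field_simp
  have hR'pos : ∀ τ ∈ Ioo (0 : ℝ) 1, 0 ≤ R' τ ∧ (0 < c → 0 < R' τ) := by
    intro τ hτ
    have h1 := (hS τ hτ).1.1
    have h2 := (hT τ hτ).1.1
    have hr := hRpos τ hτ
    have hx := hpos₁ _ (hS τ hτ).1
    have hy := hpos₂ _ (hT τ hτ).1
    have hA : 0 ≤ A := hc.trans hc₁
    have hB : 0 ≤ B := hc.trans hc₂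
    constructor
    · positivity
    · intro hc0
      have hA : 0 < A := hc0.trans_le hc₁
      have hB : 0 < B := hc0.trans_le hc₂
      positivity
  -- For `c > 0` both masses `A` and `B` are positive, so `R` is strictly increasing and the change
  -- of variable is legitimate.
  rcases hc.eq_or_lt with rfl | hc0
  · simp
  have hinj : InjOn R (Ioo 0 1) := by
    refine StrictMonoOn.injOn (strictMonoOn_of_deriv_pos (convex_Ioo _ _)
      (fun τ hτ => (hderiv τ hτ).continuousAt.continuousWithinAt) fun τ hτ => ?_)
    rw [interior_Ioo] at hτ
    rw [(hderiv τ hτ).deriv]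
    exact (hR'pos τ hτ).2 hc0
  calc ENNReal.ofReal c = ∫⁻ τ in Ioo (0 : ℝ) 1, ENNReal.ofReal c := by simp
    _ ≤ ∫⁻ τ in Ioo (0 : ℝ) 1, ENNReal.ofReal |R' τ| * ENNReal.ofReal (R τ ^ q * h₃ (R τ)) := by
        refine setLIntegral_mono' measurableSet_Ioo fun τ hτ => ?_
        rw [abs_of_nonneg (hR'pos τ hτ).1, ← ENNReal.ofReal_mul (hR'pos τ hτ).1]
        exact ENNReal.ofReal_le_ofReal (hpw τ hτ)
    _ = ∫⁻ r in R '' Ioo 0 1, ENNReal.ofReal (r ^ q * h₃ r) :=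
        (lintegral_image_eq_lintegral_abs_deriv_mul measurableSet_Ioo
          (fun τ hτ => (hderiv τ hτ).hasDerivWithinAt) hinj
          fun r => ENNReal.ofReal (r ^ q * h₃ r)).symm
    _ ≤ _ := lintegral_mono_set (image_subset_iff.2 hRpos)

/-! ### Moments of log-concave functions on a half-line -/

theorem integral_pow_mul_exp_neg_mul_Ioi {b : ℝ} (hb : 0 < b) (m : ℕ) :
    ∫ r in Ioi (0 : ℝ), r ^ m * Real.exp (-(b * r)) = m.factorial / b ^ (m + 1) := by
  have := Real.integral_rpow_mul_exp_neg_mul_Ioi (a := (m : ℝ) + 1) (by positivity) hb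
  rw [Real.Gamma_nat_eq_factorial] at this
  simp only [add_sub_cancel_right, Real.rpow_natCast] at this
  rw [this, ← Nat.cast_add_one, Real.rpow_natCast, one_div, inv_pow]
  field_simp

theorem integrableOn_pow_mul_exp_neg_mul_Ioi {b : ℝ} (hb : 0 < b) (m : ℕ) :
    IntegrableOn (fun r : ℝ => r ^ m * Real.exp (-(b * r))) (Ioi 0) := by
  refine Integrable.of_integral_ne_zero ?_
  rw [integral_pow_mul_exp_neg_mul_Ioi hb]
  positivity

/-- With `m = (k + 2) / e` one has `m^(k+2) ≤ (k+2)!`, so `x` may be replaced by `y = max x m`.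
Dividing `y^(k+2) ≤ (k+2)! ≤ (k+2)² k!` by `m² ≤ y²` costs only `((k+2)/m)² = e²`. -/
theorem pow_le_exp_two_mul_factorial {k : ℕ} {x : ℝ} (hx0 : 0 ≤ x)
    (hx : x ^ (k + 2) ≤ (k + 2).factorial) : x ^ k ≤ Real.exp 2 * k.factorial := by
  set m : ℝ := (k + 2 : ℕ) / Real.exp 1 with hm
  have hm0 : 0 < m := by positivity
  have hmf : m ^ (k + 2) ≤ (k + 2).factorial := by
    have := Real.pow_div_factorial_le_exp ((k + 2 : ℕ) : ℝ) (by positivity) (k + 2)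
    rw [div_le_iff₀ (by positivity)] at this
    rw [hm, div_pow, div_le_iff₀ (by positivity), ← Real.exp_nat_mul, mul_one, mul_comm]
    exact this
  set y := max x m with hy
  have hym : m ≤ y := le_max_right _ _
  have hy0 : 0 < y := hm0.trans_le hym
  have hyf : y ^ (k + 2) ≤ (k + 2).factorial := by
    rcases max_cases x m with h | h <;> rw [hy, h.1] <;> assumption
  have h1 : y ^ k * m ^ 2 ≤ (k + 2).factorial := by
    refine le_trans ?_ hyf
    rw [pow_add]
    gcongr
  have h2 : ((k + 2).factorial : ℝ) ≤ (k + 2 : ℕ) ^ 2 * k.factorial := by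
    rw [Nat.factorial_succ, Nat.factorial_succ]
    push_cast
    nlinarith [(by positivity : (0 : ℝ) ≤ k.factorial), (by positivity : (0 : ℝ) ≤ k * k.factorial)]
  have h3 : ((k + 2 : ℕ) : ℝ) ^ 2 = m ^ 2 * Real.exp 2 := by
    rw [hm, div_pow, ← Real.exp_nat_mul]
    norm_num
  rw [h3] at h2
  have h4 : y ^ k ≤ Real.exp 2 * k.factorial := by
    have hm2 : 0 < m ^ 2 := by positivity
    refine le_of_mul_le_mul_right ?_ hm2
    linarith
  exact le_trans (pow_le_pow_left₀ hx0 (le_max_left _ _) _) h4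

/-- A comparison of the moments of order `k` and `k + 2` of a log-concave function on a half-line,
obtained from the exponential density with the same moment of order `k`. -/
theorem pow_le_moment_of_logConcave {k : ℕ} (hk : 1 ≤ k) {h : ℝ → ℝ} {R q : ℝ} (h_zero : h 0 = 1)
    (hnn : ∀ r, 0 ≤ h r) (hR : ∀ r, R < r → h r = 0)
    (hlog : ∀ x y a b : ℝ, 0 ≤ x → 0 ≤ y → 0 < a → 0 < b → a + b = 1 →
      h x ^ a * h y ^ b ≤ h (a * x + b * y))
    (hint₁ : IntegrableOn (fun r => r ^ (k - 1) * h r) (Ioi 0))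
    (hint₂ : IntegrableOn (fun r => r ^ (k + 1) * h r) (Ioi 0))
    (hq : 0 ≤ q) (hq2 : q ^ (k + 2) = (k + 2) * ∫ r in Ioi (0 : ℝ), r ^ (k + 1) * h r) :
    q ^ k ≤ Real.exp 2 * (k * ∫ r in Ioi (0 : ℝ), r ^ (k - 1) * h r) := by
  set I₁ := ∫ r in Ioi (0 : ℝ), r ^ (k - 1) * h r with hI₁
  set I₂ := ∫ r in Ioi (0 : ℝ), r ^ (k + 1) * h r with hI₂
  have hI₁0 : 0 ≤ I₁ := setIntegral_nonneg measurableSet_Ioi fun r hr =>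
    mul_nonneg (pow_nonneg (le_of_lt hr) _) (hnn r)
  rcases hI₁0.eq_or_lt with h0 | hpos
  · have h1 := (setIntegral_eq_zero_iff_of_nonneg_ae ?_ hint₁).1 h0.symm
    · have : I₂ = 0 := by
        refine integral_eq_zero_of_ae ?_
        filter_upwards [h1, ae_restrict_mem measurableSet_Ioi] with r hr hr0
        have hr0' : (0 : ℝ) < r := hr0
        simp only [Pi.zero_apply, mul_eq_zero, pow_eq_zero_iff', hr0'.ne', false_and, false_or] at hr ⊢
        exact hr
      rw [this, mul_zero] at hq2
      have hq0 : q = 0 := pow_eq_zero_iff (by omega) |>.1 hq2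
      rw [← h0, hq0]
      simp [show k ≠ 0 by omega]
    · filter_upwards [ae_restrict_mem measurableSet_Ioi] with r hr
      exact mul_nonneg (pow_nonneg (le_of_lt hr) _) (hnn r)
  -- The rate `β` makes the integrals of `r ^ (k - 1)` against `exp (-(β * r))` and against `h`
  -- equal.
  set β : ℝ := ((k - 1).factorial / I₁) ^ ((k : ℝ)⁻¹) with hβ
  have hβ0 : 0 < β := by positivity
  have hβk : β ^ k = (k - 1).factorial / I₁ := by
    rw [hβ, Real.rpow_inv_natCast_pow (by positivity) (by omega)]
  have hJ₁ := integral_pow_mul_exp_neg_mul_Ioi hβ0 (k - 1)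
  rw [Nat.sub_add_cancel hk, hβk, div_div_cancel₀ (by positivity)] at hJ₁
  have hJ₂ := integral_pow_mul_exp_neg_mul_Ioi hβ0 (k + 1)
  -- Log-concavity of `h` makes `D` convex. It contains `0` and is bounded, so `h - exp (-(β * r))`
  -- changes sign only at `r₀ = sSup D`.
  set D : Set ℝ := {r | 0 ≤ r ∧ Real.exp (-(β * r)) ≤ h r} with hD
  have hD0 : (0 : ℝ) ∈ D := by simp [hD, h_zero]
  have hDb : BddAbove D := by
    refine ⟨R, fun r hr => ?_⟩
    by_contra! hlt
    have := hr.2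
    rw [hR r hlt] at this
    exact absurd (Real.exp_pos _) (not_lt.2 this)
  have hDconv : ∀ x ∈ D, ∀ y ∈ D, ∀ a b : ℝ, 0 < a → 0 < b → a + b = 1 → a * x + b * y ∈ D := by
    intro x hx y hy a b ha hb hab
    have hx0 := hx.1
    have hy0 := hy.1
    refine ⟨by positivity, le_trans ?_ (hlog x y a b hx.1 hy.1 ha hb hab)⟩
    calc Real.exp (-(β * (a * x + b * y))) =
          Real.exp (-(β * x)) ^ a * Real.exp (-(β * y)) ^ b := by
            rw [← Real.exp_mul, ← Real.exp_mul, ← Real.exp_add]; ring_nf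
      _ ≤ _ := by
        have := hx.2
        have := hy.2
        have := hnn x
        gcongr
  set r₀ := sSup D with hr₀
  have hlt : ∀ r, 0 < r → r < r₀ → Real.exp (-(β * r)) ≤ h r := by
    intro r hr0 hr
    obtain ⟨s, hs, hrs⟩ := exists_lt_of_lt_csSup ⟨0, hD0⟩ hr
    have hs0 : 0 < s := hr0.trans hrs
    have := hDconv 0 hD0 s hs (1 - r / s) (r / s) (by rw [sub_pos, div_lt_one hs0]; exact hrs)
      (by positivity) (by ring)
    rw [mul_zero, zero_add, div_mul_cancel₀ _ hs0.ne'] at this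
    exact this.2
  have hgt : ∀ r, 0 < r → r₀ < r → h r ≤ Real.exp (-(β * r)) := by
    intro r hr0 hr
    by_contra! hcon
    exact absurd (le_csSup hDb (⟨hr0.le, hcon.le⟩ : r ∈ D)) (not_le.2 hr)
  have hr₀0 : 0 ≤ r₀ := le_csSup hDb hD0
  have hE₁ := integrableOn_pow_mul_exp_neg_mul_Ioi hβ0 (k - 1)
  have hE₂ := integrableOn_pow_mul_exp_neg_mul_Ioi hβ0 (k + 1)
  -- The integrand equals `r^(k-1) (r² - r₀²) (exp (-(β r)) - h r)`, whose last two factors have the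
  -- same sign. The `r₀²` term integrates to `0` by the choice of `β`, leaving a comparison of the
  -- moments with weight `r^(k+1)`.
  have hmain : 0 ≤ ∫ r in Ioi (0 : ℝ), ((r ^ (k + 1) * Real.exp (-(β * r)) - r ^ (k + 1) * h r) -
      r₀ ^ 2 * (r ^ (k - 1) * Real.exp (-(β * r)) - r ^ (k - 1) * h r)) := by
    refine setIntegral_nonneg measurableSet_Ioi fun r hr => ?_
    have hr0 : 0 < r := hr
    have : r ^ (k + 1) = r ^ (k - 1) * r ^ 2 := by rw [← pow_add]; congr 1; omega
    rw [this]
    have e : r ^ (k - 1) * r ^ 2 * Real.exp (-(β * r)) - r ^ (k - 1) * r ^ 2 * h r -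
      r₀ ^ 2 * (r ^ (k - 1) * Real.exp (-(β * r)) - r ^ (k - 1) * h r) =
      r ^ (k - 1) * ((r ^ 2 - r₀ ^ 2) * (Real.exp (-(β * r)) - h r)) := by ring
    rw [e]
    refine mul_nonneg (by positivity) ?_
    rcases lt_trichotomy r r₀ with h | h | h
    · exact mul_nonneg_of_nonpos_of_nonpos (by nlinarith) (by linarith [hlt r hr0 h])
    · simp [h]
    · exact mul_nonneg (by nlinarith) (by linarith [hgt r hr0 h])
  have hs₁ : ∫ r in Ioi (0 : ℝ), (r ^ (k - 1) * Real.exp (-(β * r)) - r ^ (k - 1) * h r) = 0 := by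
    rw [integral_sub hE₁ hint₁, hJ₁, ← hI₁, sub_self]
  have hs₂ : ∫ r in Ioi (0 : ℝ), (r ^ (k + 1) * Real.exp (-(β * r)) - r ^ (k + 1) * h r) =
      (k + 1).factorial / β ^ (k + 1 + 1) - I₂ := by
    rw [integral_sub hE₂ hint₂, hJ₂, ← hI₂]
  have hs₃ := integral_sub (hE₂.sub hint₂) ((hE₁.sub hint₁).const_mul (r₀ ^ 2))
  simp only [Pi.sub_apply] at hs₃
  rw [hs₃, integral_const_mul, hs₁, hs₂, mul_zero, sub_zero] at hmain
  have hx : (q * β) ^ (k + 2) ≤ (k + 2).factorial := by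
    rw [mul_pow, hq2]
    have : I₂ ≤ (k + 1).factorial / β ^ (k + 1 + 1) := by linarith
    rw [le_div_iff₀ (by positivity)] at this
    rw [Nat.factorial_succ (k + 1)]
    push_cast
    calc _ = (k + 2) * (I₂ * β ^ (k + 1 + 1)) := by ring
      _ ≤ (k + 2) * (k + 1).factorial := by gcongr
      _ = _ := by ring
  have := pow_le_exp_two_mul_factorial (by positivity) hx
  rw [mul_pow, hβk, ← Nat.mul_factorial_pred (by omega : k ≠ 0)] at this
  push_cast at this
  have hf : (0 : ℝ) < (k - 1).factorial := by positivity
  rw [mul_div_assoc', div_le_iff₀ hpos] at this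
  refine le_of_mul_le_mul_right ?_ hf
  linarith

/-! ### Even log-concave functions and Ball's bodies -/

/-- An even log-concave function with bounded support that is positive at the origin. -/
structure IsSymmLogConcave {X : Type*} [NormedAddCommGroup X] [NormedSpace ℝ X] [MeasurableSpace X]
    (g : X → ℝ) : Prop where
  measurable : Measurable g
  nonneg : ∀ x, 0 ≤ g x
  even : ∀ x, g (-x) = g x
  logConcave : ∀ x y : X, ∀ a b : ℝ, 0 < a → 0 < b → a + b = 1 →
    g x ^ a * g y ^ b ≤ g (a • x + b • y)
  bounded : ∃ R : ℝ, 0 < R ∧ ∀ x, R < ‖x‖ → g x = 0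
  pos : 0 < g 0

/-- The moment `∫ r ^ q * g (r x) dr` along the ray spanned by `x`. -/
noncomputable def rayMoment {X : Type*} [NormedAddCommGroup X] [NormedSpace ℝ X] (q : ℕ)
    (g : X → ℝ) (x : X) : ℝ≥0∞ :=
  ∫⁻ r in Ioi (0 : ℝ), ENNReal.ofReal (r ^ q * g (r • x))

/-- Ball's body associated with the moment of order `q`. -/
def ballBody {X : Type*} [NormedAddCommGroup X] [NormedSpace ℝ X] (q : ℕ) (g : X → ℝ) : Set X :=
  {x | ENNReal.ofReal (g 0 / (q + 1)) ≤ rayMoment q g x}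

namespace IsSymmLogConcave

variable {X : Type*} [NormedAddCommGroup X] [NormedSpace ℝ X] [MeasurableSpace X] {g : X → ℝ}

theorem le_zero (hg : IsSymmLogConcave g) (x : X) : g x ≤ g 0 := by
  have := hg.logConcave x (-x) (1 / 2) (1 / 2) (by norm_num) (by norm_num) (by norm_num)
  rw [hg.even, smul_neg, add_neg_cancel] at this
  refine le_trans (le_of_eq ?_) this
  rw [← Real.rpow_add_of_nonneg (hg.nonneg x) (by norm_num) (by norm_num)]
  norm_num

theorem le_smul (hg : IsSymmLogConcave g) (x : X) {t : ℝ} (h0 : 0 ≤ t) (h1 : t ≤ 1) :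
    g x ≤ g (t • x) := by
  rcases h0.eq_or_lt with rfl | h0
  · simpa using hg.le_zero x
  rcases h1.eq_or_lt with rfl | h1
  · simp
  have := hg.logConcave 0 x (1 - t) t (by linarith) h0 (by ring)
  rw [smul_zero, zero_add] at this
  refine le_trans ?_ this
  calc g x = g x ^ (1 - t) * g x ^ t := by
        rw [← Real.rpow_add_of_nonneg (hg.nonneg x) (by linarith) h0.le]; simp
    _ ≤ _ := by
        have := hg.le_zero x
        have := hg.nonneg x
        gcongr

theorem ray_eq_zero (hg : IsSymmLogConcave g) : ∃ R : ℝ, 0 < R ∧ ∀ x : X, x ≠ 0 → ∀ r : ℝ,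
    R / ‖x‖ < r → g (r • x) = 0 := by
  obtain ⟨R, hR0, hR⟩ := hg.bounded
  refine ⟨R, hR0, fun x hx r hr => hR _ ?_⟩
  have hx0 : 0 < ‖x‖ := norm_pos_iff.2 hx
  rw [div_lt_iff₀ hx0] at hr
  have hr0 : 0 < r := by
    by_contra! h
    nlinarith
  rwa [norm_smul, Real.norm_of_nonneg hr0.le]

theorem measurable_ray [BorelSpace X] (hg : IsSymmLogConcave g) (x : X) :
    Measurable fun r : ℝ => g (r • x) :=
  hg.measurable.comp (continuous_id.smul continuous_const).measurable

theorem integrableOn_ray [BorelSpace X] (hg : IsSymmLogConcave g) (q : ℕ) {x : X} (hx : x ≠ 0) :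
    IntegrableOn (fun r : ℝ => r ^ q * g (r • x)) (Ioi 0) := by
  obtain ⟨R, hR0, hR⟩ := hg.ray_eq_zero
  have hx0 : 0 < ‖x‖ := norm_pos_iff.2 hx
  have h0 : 0 ≤ R / ‖x‖ := by positivity
  rw [← Ioc_union_Ioi_eq_Ioi h0]
  refine IntegrableOn.union ?_ ?_
  · refine Measure.integrableOn_of_bounded (M := (R / ‖x‖) ^ q * g 0) (by simp) ?_ ?_
    · exact ((measurable_id.pow_const q).mul (hg.measurable_ray x)).aestronglyMeasurable
    · filter_upwards [ae_restrict_mem measurableSet_Ioc] with r hr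
      have hr0 := hr.1.le
      have := hg.nonneg (r • x)
      rw [Real.norm_of_nonneg (by positivity)]
      have := hr.2
      have := hg.le_zero (r • x)
      gcongr
  · refine IntegrableOn.congr_fun (f := fun _ => 0) integrableOn_zero ?_ measurableSet_Ioi
    intro r hr
    simp [hR x hx r hr]

theorem rayMoment_eq [BorelSpace X] (hg : IsSymmLogConcave g) (q : ℕ) {x : X} (hx : x ≠ 0) :
    rayMoment q g x = ENNReal.ofReal (∫ r in Ioi (0 : ℝ), r ^ q * g (r • x)) := by
  rw [ofReal_integral_eq_lintegral_ofReal (hg.integrableOn_ray q hx)]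
  · rfl
  · filter_upwards [ae_restrict_mem measurableSet_Ioi] with r hr
    have hr0 : 0 < r := hr
    have := hg.nonneg (r • x)
    simp only [Pi.zero_apply]
    positivity

/-- Once `‖x‖` exceeds the support radius `R`, the ray integral stops at `R / ‖x‖ < 1`. As `g ≤ g
0`, it then falls below the threshold `g 0 / (q + 1) = ∫₀¹ r^q g(0) dr`. -/
theorem norm_le_of_mem_ballBody (hg : IsSymmLogConcave g) (q : ℕ) :
    ∃ R : ℝ, ∀ x ∈ ballBody q g, ‖x‖ ≤ R := by
  obtain ⟨R, hR0, hR⟩ := hg.ray_eq_zero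
  refine ⟨R, fun x hx => ?_⟩
  by_contra! hlt
  have hx0 : 0 < ‖x‖ := hR0.trans hlt
  have h0 : 0 < R / ‖x‖ := by positivity
  have h1 : R / ‖x‖ < 1 := by rwa [div_lt_one hx0]
  have : rayMoment q g x ≤ ENNReal.ofReal (g 0 * ((R / ‖x‖) ^ (q + 1) / (q + 1))) := by
    calc rayMoment q g x ≤ ∫⁻ r in Ioi (0 : ℝ),
          (Ioc 0 (R / ‖x‖)).indicator (fun r => ENNReal.ofReal (g 0 * r ^ q)) r := by
          refine setLIntegral_mono' measurableSet_Ioi fun r hr => ?_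
          by_cases h : r ∈ Ioc 0 (R / ‖x‖)
          · rw [indicator_of_mem h]
            refine ENNReal.ofReal_le_ofReal ?_
            rw [mul_comm]
            have hr0 := h.1.le
            have := hg.le_zero (r • x)
            gcongr
          · have h' : R / ‖x‖ < r := by
              by_contra! hh
              exact h ⟨hr, hh⟩
            simp [hR x (norm_pos_iff.1 hx0) r h']
      _ = ∫⁻ r in Ioc 0 (R / ‖x‖), ENNReal.ofReal (g 0 * r ^ q) := by
          rw [lintegral_indicator measurableSet_Ioc, Measure.restrict_restrict measurableSet_Ioc,
            inter_eq_left.2 Ioc_subset_Ioi_self]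
      _ = _ := by
          rw [← ofReal_integral_eq_lintegral_ofReal, integral_const_mul,
            ← intervalIntegral.integral_of_le h0.le, integral_pow]
          · simp
          · exact ((continuous_const.mul (continuous_pow q)).integrableOn_Ioc)
          · filter_upwards [ae_restrict_mem measurableSet_Ioc] with r hr
            have := hr.1.le
            have := hg.pos.le
            simp only [Pi.zero_apply]
            positivity
  have h2 := le_trans hx this
  have hg0 := hg.pos
  rw [ENNReal.ofReal_le_ofReal_iff (by positivity), mul_div_assoc',
    div_le_div_iff_of_pos_right (by positivity)] at h2
  have h3 : (R / ‖x‖) ^ (q + 1) < 1 := pow_lt_one₀ h0.le h1 (by omega)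
  nlinarith

theorem neg_mem_ballBody (hg : IsSymmLogConcave g) {q : ℕ} {x : X} (hx : x ∈ ballBody q g) :
    -x ∈ ballBody q g := by
  have : rayMoment q g (-x) = rayMoment q g x := by
    simp only [rayMoment, smul_neg, hg.even]
  simpa [ballBody, this] using hx

theorem rayMoment_le_smul (hg : IsSymmLogConcave g) (q : ℕ) (x : X) {t : ℝ} (h0 : 0 ≤ t)
    (h1 : t ≤ 1) : rayMoment q g x ≤ rayMoment q g (t • x) := by
  refine setLIntegral_mono' measurableSet_Ioi fun r hr => ENNReal.ofReal_le_ofReal ?_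
  have hr0 : 0 < r := hr
  rw [smul_comm]
  exact mul_le_mul_of_nonneg_left (hg.le_smul _ h0 h1) (by positivity)

/-- Monotonicity along rays makes the positivity set an interval. On its interior `log g` is
concave, hence continuous, which supplies the regularity needed for transport. -/
theorem exists_ray_interval (hg : IsSymmLogConcave g) {q : ℕ} {x : X} (hx : x ≠ 0)
    (hpos : rayMoment q g x ≠ 0) : ∃ s₀ : ℝ, 0 < s₀ ∧
      ContinuousOn (fun s : ℝ => g (s • x)) (Ioo 0 s₀) ∧ (∀ s ∈ Ioo 0 s₀, 0 < g (s • x)) ∧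
      ∀ s, s₀ < s → g (s • x) = 0 := by
  obtain ⟨R, hR0, hR⟩ := hg.ray_eq_zero
  set P : Set ℝ := {s | 0 < s ∧ 0 < g (s • x)} with hP
  have hPne : P.Nonempty := by
    by_contra h
    refine hpos ?_
    rw [rayMoment, setLIntegral_congr_fun (g := fun _ => 0) measurableSet_Ioi, lintegral_zero]
    intro r hr
    have : ¬ 0 < g (r • x) := fun h' => h ⟨r, hr, h'⟩
    have := le_antisymm (not_lt.1 this) (hg.nonneg _)
    simp [this]
  have hPb : BddAbove P := by
    refine ⟨R / ‖x‖, fun s hs => ?_⟩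
    by_contra! h
    exact hs.2.ne' (hR x hx s h)
  obtain ⟨s₁, hs₁⟩ := hPne
  have h0 : 0 < sSup P := hs₁.1.trans_le (le_csSup hPb hs₁)
  have hposI : ∀ s ∈ Ioo 0 (sSup P), 0 < g (s • x) := by
    intro s hs
    obtain ⟨t, ht, hst⟩ := exists_lt_of_lt_csSup ⟨s₁, hs₁⟩ hs.2
    refine ht.2.trans_le ?_
    have := hg.le_smul (t • x) (t := s / t) (by have := hs.1; have := ht.1; positivity)
      (by rw [div_le_one ht.1]; exact hst.le)
    rwa [smul_smul, div_mul_cancel₀ _ ht.1.ne'] at this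
  refine ⟨sSup P, h0, ?_, hposI, ?_⟩
  · have hconc : ConcaveOn ℝ (Ioo 0 (sSup P)) fun s : ℝ => Real.log (g (s • x)) := by
      rw [concaveOn_iff_forall_pos]
      refine ⟨convex_Ioo _ _, fun s hs t ht a b ha hb hab => ?_⟩
      have h1 := hposI s hs
      have h2 := hposI t ht
      have := hg.logConcave (s • x) (t • x) a b ha hb hab
      rw [smul_eq_mul, smul_eq_mul, ← Real.log_rpow h1, ← Real.log_rpow h2,
        ← Real.log_mul (by positivity) (by positivity)]
      refine Real.log_le_log (by positivity) (this.trans_eq ?_)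
      congr 1
      simp only [smul_smul, ← add_smul, smul_eq_mul]
    have hc := (hconc.continuousOn isOpen_Ioo).rexp
    exact hc.congr fun s hs => (Real.exp_log (hposI s hs)).symm
  · intro s hs
    by_contra h
    have : 0 < g (s • x) := lt_of_le_of_ne (hg.nonneg _) (Ne.symm h)
    exact absurd (le_csSup hPb (⟨h0.trans hs, this⟩ : s ∈ P)) (not_le.2 hs)

/-- Ball's inequality applies on the rays through `x`, `y` and `a • x + b • y`. If `r⁻¹ = a / s + b
/ t`, then `r • (a • x + b • y)` is the convex combination of `s • x` and `t • y` with weights `a r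
/ s` and `b r / t`, so log-concavity gives the required pointwise estimate. The origin is handled
separately by monotonicity along rays. -/
theorem convex_ballBody [BorelSpace X] (hg : IsSymmLogConcave g) (q : ℕ) :
    Convex ℝ (ballBody q g) := by
  rw [convex_iff_forall_pos]
  intro x hx y hy a b ha hb hab
  rcases eq_or_ne x 0 with rfl | hx0
  · rw [smul_zero, zero_add]
    exact le_trans hy (hg.rayMoment_le_smul q y hb.le (by linarith))
  rcases eq_or_ne y 0 with rfl | hy0
  · rw [smul_zero, add_zero]
    exact le_trans hx (hg.rayMoment_le_smul q x ha.le (by linarith))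
  have hg0 := hg.pos
  have hc : 0 < g 0 / (q + 1) := by positivity
  have hne : ∀ z ∈ ballBody q g, rayMoment q g z ≠ 0 := fun z hz =>
    (lt_of_lt_of_le (ENNReal.ofReal_pos.2 hc) hz).ne'
  have key : ∀ z ∈ ballBody q g, z ≠ 0 → ∀ s₀, 0 < s₀ → (∀ s, s₀ < s → g (s • z) = 0) →
      g 0 / (q + 1) ≤ ∫ s in Ioo 0 s₀, s ^ q * g (s • z) := by
    intro z hz hz0 s₀ hs₀ hs
    have h := hz
    rw [ballBody, mem_ofPred_eq, hg.rayMoment_eq q hz0, ENNReal.ofReal_le_ofReal_iff'] at h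
    refine (h.resolve_right (not_le.2 hc)).trans_eq ?_
    rw [← integral_Ioc_eq_integral_Ioo, ← Ioc_union_Ioi_eq_Ioi hs₀.le, setIntegral_union
      (Ioc_disjoint_Ioi le_rfl) measurableSet_Ioi
      ((hg.integrableOn_ray q hz0).mono_set Ioc_subset_Ioi_self)
      ((hg.integrableOn_ray q hz0).mono_set (Ioi_subset_Ioi hs₀.le)),
      setIntegral_congr_fun (g := fun _ => 0) measurableSet_Ioi fun s h => by simp [hs s h]]
    simp
  obtain ⟨s₀, hs₀, hcs, hps, hzs⟩ := hg.exists_ray_interval hx0 (hne x hx)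
  obtain ⟨t₀, ht₀, hct, hpt, hzt⟩ := hg.exists_ray_interval hy0 (hne y hy)
  refine le_lintegral_pow_mul_of_harmonic_mean (q := q) (h₁ := fun s => g (s • x))
    (h₂ := fun s => g (s • y)) (h₃ := fun s => g (s • (a • x + b • y))) (l := b) hs₀ ht₀
    ⟨hb, by linarith⟩ hc.le hcs hct hps hpt
    ((hg.integrableOn_ray q hx0).mono_set Ioo_subset_Ioi_self)
    ((hg.integrableOn_ray q hy0).mono_set Ioo_subset_Ioi_self)
    (key x hx hx0 s₀ hs₀ hzs) (key y hy hy0 t₀ ht₀ hzt) ?_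
  intro s hs t ht r hr hinv
  have hs0 := hs.1
  have ht0 := ht.1
  have ha' : 1 - b = a := by linarith
  rw [ha'] at hinv ⊢
  refine (hg.logConcave (s • x) (t • y) (a * r / s) (b * r / t) (by positivity) (by positivity)
    ?_).trans_eq ?_
  · have : r * r⁻¹ = 1 := mul_inv_cancel₀ hr.ne'
    rw [hinv] at this
    exact Eq.trans (by ring) this
  · congr 1
    rw [smul_smul, smul_smul, smul_add, smul_smul, smul_smul, div_mul_cancel₀ _ hs0.ne',
      div_mul_cancel₀ _ ht0.ne', mul_comm r a, mul_comm r b]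

theorem measurable_rayMoment [BorelSpace X] [SecondCountableTopology X]
    (hg : IsSymmLogConcave g) (q : ℕ) : Measurable (rayMoment q g) := by
  have : Measurable fun p : X × ℝ => ENNReal.ofReal (p.2 ^ q * g (p.2 • p.1)) := by
    refine ENNReal.measurable_ofReal.comp ?_
    refine (measurable_snd.pow_const q).mul (hg.measurable.comp ?_)
    exact (continuous_snd.smul continuous_fst).measurable
  exact this.lintegral_prod_right'

theorem measurableSet_ballBody [BorelSpace X] [SecondCountableTopology X]
    (hg : IsSymmLogConcave g) (q : ℕ) : MeasurableSet (ballBody q g) :=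
  measurableSet_le measurable_const (hg.measurable_rayMoment q)

/-- The ray moment is homogeneous of degree `-(q + 1)`; hence `ρ` is the radius of Ball's body in
the direction `x`. -/
theorem smul_mem_ballBody_iff [BorelSpace X] (hg : IsSymmLogConcave g) {q : ℕ} {x : X} (hx : x ≠ 0)
    {ρ : ℝ} (hρ : 0 ≤ ρ)
    (hρ' : ρ ^ (q + 1) = (q + 1) * ((∫ r in Ioi (0 : ℝ), r ^ q * g (r • x)) / g 0))
    {t : ℝ} (ht : 0 < t) : t • x ∈ ballBody q g ↔ t ≤ ρ := by
  have hint : ∫ r in Ioi (0 : ℝ), r ^ q * g (r • t • x) =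
      (∫ r in Ioi (0 : ℝ), r ^ q * g (r • x)) / t ^ (q + 1) := by
    have h := integral_comp_mul_right_Ioi (fun r => r ^ q * g (r • x)) 0 ht
    rw [zero_mul, smul_eq_mul] at h
    have h' : (∫ r in Ioi (0 : ℝ), r ^ q * g (r • t • x)) * t ^ q =
        ∫ r in Ioi (0 : ℝ), (r * t) ^ q * g ((r * t) • x) := by
      rw [← integral_mul_const]
      refine integral_congr_ae (Filter.Eventually.of_forall fun r => ?_)
      simp only [smul_smul, mul_pow]
      ring
    rw [eq_div_iff (by positivity), pow_succ, ← mul_assoc, h', h, mul_comm t⁻¹,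
      inv_mul_cancel_right₀ ht.ne']
  have hg0 := hg.pos
  rw [ballBody, mem_ofPred_eq, hg.rayMoment_eq q (smul_ne_zero ht.ne' hx), hint,
    ENNReal.ofReal_le_ofReal_iff', or_iff_left (not_le.2 (by positivity)),
    ← pow_le_pow_iff_left₀ ht.le hρ (Nat.succ_ne_zero q), hρ', div_le_div_iff₀ (by positivity)
    (by positivity), mul_div_assoc', le_div_iff₀ hg0, mul_comm (g 0), mul_comm ((q : ℝ) + 1)]

theorem exists_radius (hg : IsSymmLogConcave g) (q : ℕ) (x : X) : ∃ ρ : ℝ, 0 ≤ ρ ∧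
    ρ ^ (q + 1) = (q + 1) * ((∫ r in Ioi (0 : ℝ), r ^ q * g (r • x)) / g 0) := by
  have h0 : 0 ≤ (q + 1) * ((∫ r in Ioi (0 : ℝ), r ^ q * g (r • x)) / g 0) := by
    have := hg.pos
    have : 0 ≤ ∫ r in Ioi (0 : ℝ), r ^ q * g (r • x) :=
      setIntegral_nonneg measurableSet_Ioi fun r hr =>
        mul_nonneg (pow_nonneg (le_of_lt hr) _) (hg.nonneg _)
    positivity
  refine ⟨((q + 1) * ((∫ r in Ioi (0 : ℝ), r ^ q * g (r • x)) / g 0)) ^ (((q + 1 : ℕ) : ℝ)⁻¹),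
    by positivity, ?_⟩
  rw [Real.rpow_inv_natCast_pow h0 (Nat.succ_ne_zero q)]

theorem lintegral_ray_ballBody [BorelSpace X] (hg : IsSymmLogConcave g) {q : ℕ} {x : X}
    (hx : x ≠ 0) {ρ : ℝ} (hρ : 0 ≤ ρ)
    (hρ' : ρ ^ (q + 1) = (q + 1) * ((∫ r in Ioi (0 : ℝ), r ^ q * g (r • x)) / g 0)) (m : ℕ) :
    ∫⁻ r in Ioi (0 : ℝ), ENNReal.ofReal (r ^ m) * (ballBody q g).indicator 1 (r • x) =
      ENNReal.ofReal (ρ ^ (m + 1) / (m + 1)) := by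
  calc _ = ∫⁻ r in Ioi (0 : ℝ), (Ioc 0 ρ).indicator (fun r => ENNReal.ofReal (r ^ m)) r := by
        refine setLIntegral_congr_fun measurableSet_Ioi fun r hr => ?_
        have := hg.smul_mem_ballBody_iff hx hρ hρ' hr
        by_cases h : r ≤ ρ
        · have hm : r ∈ Ioc 0 ρ := ⟨hr, h⟩
          simp [hm, this.2 h]
        · have hm : r ∉ Ioc 0 ρ := fun h' => h h'.2
          simp [hm, mt this.1 h]
    _ = ∫⁻ r in Ioc 0 ρ, ENNReal.ofReal (r ^ m) := by
        rw [lintegral_indicator measurableSet_Ioc, Measure.restrict_restrict measurableSet_Ioc,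
          inter_eq_left.2 Ioc_subset_Ioi_self]
    _ = _ := by
        rw [← ofReal_integral_eq_lintegral_ofReal, ← intervalIntegral.integral_of_le hρ,
          integral_pow]
        · simp
        · exact (continuous_pow m).integrableOn_Ioc
        · filter_upwards [ae_restrict_mem measurableSet_Ioc] with r hr
          exact pow_nonneg hr.1.le _

/-- This is the exponential comparison for the normalised profile `g (r • x) / g 0`. The left side
is the contribution of one direction to the volume of Ball's body in polar coordinates. -/
theorem radius_pow_le [BorelSpace X] (hg : IsSymmLogConcave g) {k : ℕ} (hk : 1 ≤ k) {x : X}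
    (hx : x ≠ 0) {ρ : ℝ} (hρ : 0 ≤ ρ)
    (hρ' : ρ ^ (k + 2) = (k + 2) * ((∫ r in Ioi (0 : ℝ), r ^ (k + 1) * g (r • x)) / g 0)) :
    ρ ^ k / k ≤ Real.exp 2 / g 0 * ∫ r in Ioi (0 : ℝ), r ^ (k - 1) * g (r • x) := by
  have hg0 := hg.pos
  obtain ⟨R, hR0, hR⟩ := hg.ray_eq_zero
  have e : ∀ m : ℕ, ∫ r in Ioi (0 : ℝ), r ^ m * (g (r • x) / g 0) =
      (∫ r in Ioi (0 : ℝ), r ^ m * g (r • x)) / g 0 := by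
    intro m
    rw [← integral_div]
    simp only [mul_div_assoc]
  have hi : ∀ m : ℕ, IntegrableOn (fun r : ℝ => r ^ m * (g (r • x) / g 0)) (Ioi 0) := by
    intro m
    have := (hg.integrableOn_ray m hx).div_const (g 0)
    simpa only [IntegrableOn, mul_div_assoc] using this
  have := pow_le_moment_of_logConcave hk (h := fun r => g (r • x) / g 0) (R := R / ‖x‖) (q := ρ)
    (by simp [hg0.ne']) (fun r => div_nonneg (hg.nonneg _) hg0.le)
    (fun r hr => by simp [hR x hx r hr]) ?_ (hi _) (hi _) hρ (by rw [e, hρ'])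
  · rw [e] at this
    have hk0 : (0 : ℝ) < k := by exact_mod_cast hk
    rw [div_le_iff₀ hk0]
    refine this.trans_eq ?_
    ring
  · intro s t a b _ _ ha hb hab
    have h1 := hg.logConcave (s • x) (t • x) a b ha hb hab
    rw [Real.div_rpow (hg.nonneg _) hg0.le, Real.div_rpow (hg.nonneg _) hg0.le,
      div_mul_div_comm, ← Real.rpow_add hg0, hab, Real.rpow_one]
    rw [smul_smul, smul_smul, ← add_smul] at h1
    gcongr

end IsSymmLogConcave

theorem lintegral_eq_lintegral_sphere {X : Type*} [NormedAddCommGroup X] [NormedSpace ℝ X]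
    [FiniteDimensional ℝ X] [Nontrivial X] [MeasurableSpace X] [BorelSpace X] (μ : Measure X)
    [μ.IsAddHaarMeasure] {F : X → ℝ≥0∞} (hF : Measurable F) :
    ∫⁻ x, F x ∂μ = ∫⁻ u : sphere (0 : X) 1, (∫⁻ r in Ioi (0 : ℝ),
      ENNReal.ofReal (r ^ (Module.finrank ℝ X - 1)) * F (r • (u : X))) ∂μ.toSphere := by
  have h1 : ∫⁻ x, F x ∂μ = ∫⁻ x : ({0}ᶜ : Set X), F x ∂(μ.comap (↑)) := by
    rw [lintegral_subtype_comap (measurableSet_singleton _).compl, restrict_compl_singleton]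
  have hG : Measurable fun p : sphere (0 : X) 1 × Ioi (0 : ℝ) => F ((p.2 : ℝ) • (p.1 : X)) :=
    hF.comp (by fun_prop)
  have h2 := (μ.measurePreserving_homeomorphUnitSphereProd).lintegral_comp hG
  have h3 : ∀ x : ({0}ᶜ : Set X), ((homeomorphUnitSphereProd X x).2 : ℝ) •
      ((homeomorphUnitSphereProd X x).1 : X) = x := by
    intro x
    have := (homeomorphUnitSphereProd X).symm_apply_apply x
    exact congrArg Subtype.val this
  simp only [h3] at h2
  rw [h1, h2, lintegral_prod _ hG.aemeasurable]
  refine lintegral_congr fun u => ?_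
  have hu : Measurable fun r : Ioi (0 : ℝ) => F ((r : ℝ) • (u : X)) := hF.comp (by fun_prop)
  rw [Measure.volumeIoiPow, lintegral_withDensity_eq_lintegral_mul _ (by fun_prop) hu]
  exact lintegral_subtype_comap measurableSet_Ioi
    (fun r : ℝ => ENNReal.ofReal (r ^ (Module.finrank ℝ X - 1)) * F (r • (u : X)))

namespace IsSymmLogConcave

variable {X : Type*} [NormedAddCommGroup X] [NormedSpace ℝ X] [FiniteDimensional ℝ X]
  [Nontrivial X] [MeasurableSpace X] [BorelSpace X] {g : X → ℝ}

theorem measure_ballBody_le (hg : IsSymmLogConcave g) (μ : Measure X) [μ.IsAddHaarMeasure] :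
    μ (ballBody (Module.finrank ℝ X + 1) g) ≤
      ENNReal.ofReal (Real.exp 2 / g 0) * ∫⁻ x, ENNReal.ofReal (g x) ∂μ := by
  have hk : 1 ≤ Module.finrank ℝ X := Module.finrank_pos
  set k := Module.finrank ℝ X with hkdef
  have hB := hg.measurableSet_ballBody (k + 1)
  have hg0 := hg.pos
  rw [← lintegral_indicator_one hB, lintegral_eq_lintegral_sphere μ (measurable_one.indicator hB),
    lintegral_eq_lintegral_sphere μ hg.measurable.ennreal_ofReal, ← lintegral_const_mul']
  · refine lintegral_mono fun u => ?_
    have hu : (u : X) ≠ 0 := ne_zero_of_mem_unit_sphere u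
    obtain ⟨ρ, hρ, hρ'⟩ := hg.exists_radius (k + 1) (u : X)
    rw [hg.lintegral_ray_ballBody hu hρ hρ']
    have := hg.radius_pow_le hk hu hρ (by rw [hρ']; push_cast; ring)
    have e : ((k - 1 : ℕ) : ℝ) + 1 = k := by exact_mod_cast Nat.sub_add_cancel hk
    rw [← hkdef, Nat.sub_add_cancel hk, e]
    refine (ENNReal.ofReal_le_ofReal this).trans_eq ?_
    rw [ENNReal.ofReal_mul (by positivity), ← hg.rayMoment_eq (k - 1) hu, rayMoment]
    congr 1
    refine setLIntegral_congr_fun measurableSet_Ioi fun r hr => ?_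
    rw [ENNReal.ofReal_mul (pow_nonneg (le_of_lt hr) _)]
  · exact ENNReal.ofReal_ne_top

/-- The order `k + 1` is chosen for this identity: in polar coordinates a quadratic form adds `r²`
to the Jacobian `r^(k-1)`, so the radial integral is exactly the moment defining the body. -/
theorem setLIntegral_sq_ballBody (hg : IsSymmLogConcave g) (μ : Measure X) [μ.IsAddHaarMeasure]
    (l : X →L[ℝ] ℝ) :
    ∫⁻ x in ballBody (Module.finrank ℝ X + 1) g, ENNReal.ofReal (l x ^ 2) ∂μ =
      ENNReal.ofReal (1 / g 0) * ∫⁻ x, ENNReal.ofReal (l x ^ 2 * g x) ∂μ := by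
  have hk : 1 ≤ Module.finrank ℝ X := Module.finrank_pos
  set k := Module.finrank ℝ X with hkdef
  have hB := hg.measurableSet_ballBody (k + 1)
  have hg0 := hg.pos
  have hl : Measurable fun x => ENNReal.ofReal (l x ^ 2) := by fun_prop
  have hl' : Measurable fun x => ENNReal.ofReal (l x ^ 2 * g x) :=
    ENNReal.measurable_ofReal.comp ((by fun_prop : Measurable fun x => l x ^ 2).mul hg.measurable)
  rw [← lintegral_indicator hB, lintegral_eq_lintegral_sphere μ (hl.indicator hB),
    lintegral_eq_lintegral_sphere μ hl', ← lintegral_const_mul' _ _ ENNReal.ofReal_ne_top]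
  refine lintegral_congr fun u => ?_
  have hu : (u : X) ≠ 0 := ne_zero_of_mem_unit_sphere u
  obtain ⟨ρ, hρ, hρ'⟩ := hg.exists_radius (k + 1) (u : X)
  have hpow : ∀ r : ℝ, r ^ (k + 1) = r ^ (k - 1) * r ^ 2 := by
    intro r
    rw [← pow_add]; congr 1; omega
  have h1 : ∫⁻ r in Ioi (0 : ℝ), ENNReal.ofReal (r ^ (k - 1)) *
      (ballBody (k + 1) g).indicator (fun x => ENNReal.ofReal (l x ^ 2)) (r • (u : X)) =
      ENNReal.ofReal (l u ^ 2) * ∫⁻ r in Ioi (0 : ℝ), ENNReal.ofReal (r ^ (k + 1)) *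
        (ballBody (k + 1) g).indicator 1 (r • (u : X)) := by
    rw [← lintegral_const_mul' _ _ ENNReal.ofReal_ne_top]
    refine setLIntegral_congr_fun measurableSet_Ioi fun r hr => ?_
    have hr0 : 0 < r := hr
    by_cases h : r • (u : X) ∈ ballBody (k + 1) g
    · simp only [indicator_of_mem h, map_smul, smul_eq_mul, Pi.one_apply, mul_one]
      rw [← ENNReal.ofReal_mul (by positivity), ← ENNReal.ofReal_mul (by positivity), hpow]
      congr 1; ring
    · simp [indicator_of_notMem h]
  have h2 : ∫⁻ r in Ioi (0 : ℝ), ENNReal.ofReal (r ^ (k - 1)) *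
      ENNReal.ofReal (l (r • (u : X)) ^ 2 * g (r • (u : X))) =
      ENNReal.ofReal (l u ^ 2) * rayMoment (k + 1) g (u : X) := by
    rw [rayMoment, ← lintegral_const_mul' _ _ ENNReal.ofReal_ne_top]
    refine setLIntegral_congr_fun measurableSet_Ioi fun r hr => ?_
    have hr0 : 0 < r := hr
    simp only [map_smul, smul_eq_mul]
    rw [← ENNReal.ofReal_mul (by positivity), ← ENNReal.ofReal_mul (by positivity), hpow]
    congr 1; ring
  rw [h1, h2, hg.lintegral_ray_ballBody hu hρ hρ', hρ', hg.rayMoment_eq _ hu, mul_left_comm,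
    ← ENNReal.ofReal_mul (p := 1 / g 0) (by positivity)]
  congr 2
  push_cast
  field_simp

end IsSymmLogConcave

/-- An even log-concave density with isotropic covariance gives rise to an isotropic convex body. -/
theorem IsSymmLogConcave.exists_isotropic_body {k : ℕ} (hk : 1 ≤ k)
    {g : EuclideanSpace ℝ (Fin k) → ℝ} (hg : IsSymmLogConcave g) {a : ℝ} (ha : 0 < a)
    (hiso : ∀ θ : EuclideanSpace ℝ (Fin k), ‖θ‖ = 1 →
      ∫⁻ x, ENNReal.ofReal (inner ℝ x θ ^ 2 * g x) = ENNReal.ofReal a) :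
    ∃ B : Set (EuclideanSpace ℝ (Fin k)), IsSymmConvexBody B ∧
      (∀ θ : EuclideanSpace ℝ (Fin k), ‖θ‖ = 1 → ∫ x in B, inner ℝ x θ ^ 2 = a / g 0) ∧
      volume B ≤ ENNReal.ofReal (Real.exp 2 / g 0) * ∫⁻ x, ENNReal.ofReal (g x) := by
  have : Nonempty (Fin k) := ⟨⟨0, hk⟩⟩
  have hg0 := hg.pos
  set q := Module.finrank ℝ (EuclideanSpace ℝ (Fin k)) + 1 with hq
  set B := ballBody q g with hB
  have hconv : Convex ℝ B := hg.convex_ballBody q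
  -- Passing to the closure secures compactness, and the frontier of a convex set is null, so no
  -- integral changes.
  have hae : closure B =ᵐ[volume] B :=
    closure_ae_eq_of_null_frontier (hconv.addHaar_frontier volume)
  obtain ⟨R, hR⟩ := hg.norm_le_of_mem_ballBody q
  have hbdd : Bornology.IsBounded B := isBounded_iff_forall_norm_le.2 ⟨R, hR⟩
  have hint : ∀ θ : EuclideanSpace ℝ (Fin k), ‖θ‖ = 1 →
      ∫ x in closure B, inner ℝ x θ ^ 2 = a / g 0 := by
    intro θ hθ
    rw [setIntegral_congr_set hae, integral_eq_lintegral_of_nonneg_ae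
      (Filter.Eventually.of_forall fun x => by positivity)
      (by fun_prop : Continuous fun x => inner ℝ x θ ^ 2).aestronglyMeasurable]
    have := hg.setLIntegral_sq_ballBody volume (innerSL ℝ θ)
    simp only [innerSL_apply_apply, real_inner_comm _ θ] at this
    rw [← hq, hiso θ hθ, ← ENNReal.ofReal_mul (by positivity)] at this
    rw [this, ENNReal.toReal_ofReal (by positivity)]
    ring
  refine ⟨closure B, ⟨hconv.closure, ?_, ?_, ?_⟩, hint, ?_⟩
  · exact hbdd.isCompact_closure
  -- A convex set with empty interior is null, which contradicts the positive second moment `a / g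
  -- 0`.
  · by_contra hemp
    rw [not_nonempty_iff_eq_empty] at hemp
    have h0 : volume (closure B) = 0 := by
      have := hconv.closure.addHaar_frontier volume
      rwa [isClosed_closure.frontier_eq, hemp, sdiff_empty] at this
    obtain ⟨θ, hθ⟩ : ∃ θ : EuclideanSpace ℝ (Fin k), ‖θ‖ = 1 := exists_norm_eq _ zero_le_one
    have := hint θ hθ
    rw [Measure.restrict_zero_set h0, integral_zero_measure] at this
    have : 0 < a / g 0 := by positivity
    linarith
  · have : -B = B := by
      ext x
      refine ⟨fun h => ?_, fun h => hg.neg_mem_ballBody h⟩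
      simpa using hg.neg_mem_ballBody h
    have h := (Homeomorph.neg (EuclideanSpace ℝ (Fin k))).preimage_closure B
    simp only [Homeomorph.coe_neg, neg_preimage, this] at h
    exact h
  · rw [measure_congr hae]
    exact hg.measure_ballBody_le volume

/-! ### The isotropic constant of a body in isotropic position -/

theorem LinearMap.det_adjoint_eq {E : Type*} [NormedAddCommGroup E] [InnerProductSpace ℝ E]
    [FiniteDimensional ℝ E] (f : E →ₗ[ℝ] E) : LinearMap.det (LinearMap.adjoint f) = LinearMap.det f := by
  let b := stdOrthonormalBasis ℝ E
  rw [← LinearMap.det_toMatrix b.toBasis, ← LinearMap.det_toMatrix b.toBasis,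
    LinearMap.toMatrix_adjoint, Matrix.det_conjTranspose, star_trivial]

/-- The symmetric operator `f f* - s` has zero quadratic form, so `f f* = s • id`; take
determinants. -/
theorem LinearMap.det_sq_of_norm_adjoint {E : Type*} [NormedAddCommGroup E] [InnerProductSpace ℝ E]
    [FiniteDimensional ℝ E] (f : E →ₗ[ℝ] E) {s : ℝ}
    (h : ∀ w, ‖LinearMap.adjoint f w‖ ^ 2 = s * ‖w‖ ^ 2) :
    LinearMap.det f ^ 2 = s ^ Module.finrank ℝ E := by
  have hs : f ∘ₗ LinearMap.adjoint f = s • LinearMap.id := by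
    have hsym : (f ∘ₗ LinearMap.adjoint f - s • LinearMap.id).IsSymmetric := by
      intro x y
      simp only [LinearMap.sub_apply, LinearMap.comp_apply, LinearMap.smul_apply, LinearMap.id_apply,
        inner_sub_left, inner_sub_right, inner_smul_left, inner_smul_right]
      rw [← LinearMap.adjoint_inner_right, ← LinearMap.adjoint_inner_left f]
      simp
    refine sub_eq_zero.1 (hsym.inner_map_self_eq_zero.1 fun x => ?_)
    have := h x
    rw [← real_inner_self_eq_norm_sq, ← real_inner_self_eq_norm_sq, LinearMap.adjoint_inner_right] at this
    simp only [LinearMap.sub_apply, LinearMap.comp_apply, LinearMap.smul_apply, LinearMap.id_apply,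
      inner_sub_left, inner_smul_left]
    simp [this]
  have := congrArg LinearMap.det hs
  rw [LinearMap.det_comp, LinearMap.det_adjoint_eq, LinearMap.det_smul, LinearMap.det_id, mul_one,
    ← sq] at this
  exact this

theorem setIntegral_image_linearEquiv {E : Type*} [NormedAddCommGroup E] [InnerProductSpace ℝ E]
    [FiniteDimensional ℝ E] [MeasurableSpace E] [BorelSpace E] (T : E ≃ₗ[ℝ] E) {K : Set E}
    (hK : MeasurableSet K) (f : E → ℝ) :
    ∫ x in T '' K, f x = |LinearMap.det (T : E →ₗ[ℝ] E)| * ∫ x in K, f (T x) := by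
  have := integral_image_eq_integral_abs_det_fderiv_smul volume hK (f := T)
    (f' := fun _ => (LinearMap.toContinuousLinearMap (T : E →ₗ[ℝ] E)))
    (fun x _ => (LinearMap.toContinuousLinearMap (T : E →ₗ[ℝ] E)).hasFDerivAt.hasFDerivWithinAt)
    T.injective.injOn f
  rw [this, integral_smul, smul_eq_mul]
  rfl

theorem setIntegral_inner_sq_eq {E : Type*} [NormedAddCommGroup E] [InnerProductSpace ℝ E]
    [MeasurableSpace E] {μ : Measure E} {K : Set E} {a : ℝ}
    (h : ∀ θ : E, ‖θ‖ = 1 → ∫ x in K, inner ℝ x θ ^ 2 ∂μ = a) (w : E) :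
    ∫ x in K, inner ℝ x w ^ 2 ∂μ = a * ‖w‖ ^ 2 := by
  rcases eq_or_ne w 0 with rfl | hw
  · simp
  have hw' : ‖w‖ ≠ 0 := norm_ne_zero_iff.2 hw
  rw [← h (‖w‖⁻¹ • w) (by rw [norm_smul, norm_inv, norm_norm, inv_mul_cancel₀ hw']),
    ← integral_mul_const]
  congr 1
  ext x
  rw [inner_smul_right]
  field_simp

section IsotropicConstant

variable {n : ℕ} {K : Set (EuclideanSpace ℝ (Fin n))} {a : ℝ}

/-- Uniqueness of the isotropic constant. If both `K` and `T '' K` are isotropic, the adjoint of `T`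
scales all norms equally (when `a > 0`), so the scale is determined by `|det T|`, which is the
reciprocal of the volume of `K`. -/
theorem IsIsotropicValue.sq_mul_rpow (hn : 1 ≤ n) (hK : MeasurableSet K)
    (ha : ∀ θ : EuclideanSpace ℝ (Fin n), ‖θ‖ = 1 → ∫ x in K, inner ℝ x θ ^ 2 = a) {c : ℝ}
    (hc : IsIsotropicValue K c) : c ^ 2 * volume.real K ^ (1 + 2 / (n : ℝ)) = a := by
  obtain ⟨hc0, T, hT, hTc⟩ := hc
  set d := LinearMap.det (T : EuclideanSpace ℝ (Fin n) →ₗ[ℝ] EuclideanSpace ℝ (Fin n)) with hd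
  have hn0 : (n : ℝ) ≠ 0 := by positivity
  have hdv : |d| * volume.real K = 1 := by
    have h := Measure.addHaar_image_linearMap volume (T : EuclideanSpace ℝ (Fin n) →ₗ[ℝ] EuclideanSpace ℝ (Fin n)) K
    rw [LinearEquiv.coe_coe, hT] at h
    have := congrArg ENNReal.toReal h
    rw [ENNReal.toReal_mul, ENNReal.toReal_ofReal (abs_nonneg _), ENNReal.toReal_one] at this
    exact this.symm
  have hv : 0 < volume.real K := lt_of_le_of_ne measureReal_nonneg fun h => by
    rw [← h, mul_zero] at hdv
    exact zero_ne_one hdv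
  have hd0 : 0 < |d| := by
    by_contra! h
    nlinarith
  have hadj : ∀ w : EuclideanSpace ℝ (Fin n), |d| * (a * ‖LinearMap.adjoint
      (T : EuclideanSpace ℝ (Fin n) →ₗ[ℝ] EuclideanSpace ℝ (Fin n)) w‖ ^ 2) =
      c ^ 2 * ‖w‖ ^ 2 := by
    intro w
    rw [← setIntegral_inner_sq_eq hTc w, setIntegral_image_linearEquiv T hK,
      ← setIntegral_inner_sq_eq ha]
    simp only [LinearMap.adjoint_inner_right, LinearEquiv.coe_coe]
    rfl
  have ha0 : 0 ≤ a := by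
    have : Nonempty (Fin n) := ⟨⟨0, hn⟩⟩
    obtain ⟨θ, hθ⟩ : ∃ θ : EuclideanSpace ℝ (Fin n), ‖θ‖ = 1 := exists_norm_eq _ zero_le_one
    rw [← ha θ hθ]
    exact integral_nonneg fun x => sq_nonneg _
  rcases ha0.eq_or_lt with rfl | ha0
  · have : Nonempty (Fin n) := ⟨⟨0, hn⟩⟩
    obtain ⟨θ, hθ⟩ : ∃ θ : EuclideanSpace ℝ (Fin n), ‖θ‖ = 1 := exists_norm_eq _ zero_le_one
    have := hadj θ
    rw [hθ] at this
    simp only [zero_mul, mul_zero, one_pow, mul_one] at this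
    rw [← this, zero_mul]
  have hdet := LinearMap.det_sq_of_norm_adjoint
    (T : EuclideanSpace ℝ (Fin n) →ₗ[ℝ] EuclideanSpace ℝ (Fin n)) (s := c ^ 2 / (|d| * a)) fun w => by
    rw [div_mul_eq_mul_div, eq_div_iff (by positivity), ← hadj w]
    ring
  rw [finrank_euclideanSpace_fin, ← hd, ← sq_abs] at hdet
  have hs : c ^ 2 / (|d| * a) = |d| ^ (2 / (n : ℝ)) := by
    rw [← Real.pow_rpow_inv_natCast (x := c ^ 2 / (|d| * a)) (n := n) (by positivity) (by omega),
      ← hdet, ← Real.rpow_natCast, ← Real.rpow_mul hd0.le]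
    rfl
  have hvd : volume.real K = |d|⁻¹ := (inv_eq_of_mul_eq_one_right hdv).symm
  rw [div_eq_iff (by positivity)] at hs
  rw [hs, hvd, Real.inv_rpow hd0.le, Real.rpow_add hd0, Real.rpow_one]
  field_simp

/-- The homothety of ratio `Vol(K)^(-1/n)` normalises the volume and preserves isotropy. -/
theorem isIsotropicValue_of_sq_mul_rpow (hn : 1 ≤ n) (hK : MeasurableSet K)
    (hv : 0 < volume.real K)
    (ha : ∀ θ : EuclideanSpace ℝ (Fin n), ‖θ‖ = 1 → ∫ x in K, inner ℝ x θ ^ 2 = a) {c : ℝ}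
    (hc0 : 0 ≤ c) (hc : c ^ 2 * volume.real K ^ (1 + 2 / (n : ℝ)) = a) :
    IsIsotropicValue K c := by
  set v := volume.real K with hvdef
  have hn0 : (n : ℝ) ≠ 0 := by positivity
  set t : ℝ := v ^ (-(1 / (n : ℝ))) with ht
  have ht0 : 0 < t := by positivity
  let T : EuclideanSpace ℝ (Fin n) ≃ₗ[ℝ] EuclideanSpace ℝ (Fin n) :=
    LinearEquiv.smulOfNeZero ℝ _ t ht0.ne'
  have hTdet : LinearMap.det (T : EuclideanSpace ℝ (Fin n) →ₗ[ℝ] EuclideanSpace ℝ (Fin n)) = v⁻¹ := by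
    have : (T : EuclideanSpace ℝ (Fin n) →ₗ[ℝ] EuclideanSpace ℝ (Fin n)) = t • LinearMap.id := by
      ext x; simp [T]
    rw [this, LinearMap.det_smul, LinearMap.det_id, mul_one, finrank_euclideanSpace_fin, ht,
      ← Real.rpow_natCast, ← Real.rpow_mul hv.le, ← Real.rpow_neg_one]
    congr 1
    field_simp
  refine ⟨hc0, T, ?_, fun θ hθ => ?_⟩
  · have h := Measure.addHaar_image_linearMap volume
      (T : EuclideanSpace ℝ (Fin n) →ₗ[ℝ] EuclideanSpace ℝ (Fin n)) K
    rw [LinearEquiv.coe_coe, hTdet] at h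
    have hK' : volume K = ENNReal.ofReal v := by
      rw [hvdef, measureReal_def, ENNReal.ofReal_toReal]
      intro h
      simp [hvdef, measureReal_def, h] at hv
    rw [h, hK', ← ENNReal.ofReal_mul (abs_nonneg _), abs_of_pos (by positivity),
      inv_mul_cancel₀ hv.ne', ENNReal.ofReal_one]
  · rw [setIntegral_image_linearEquiv T hK, hTdet, abs_of_pos (by positivity)]
    have : ∀ x, inner ℝ (T x) θ ^ 2 = t ^ 2 * inner ℝ x θ ^ 2 := by
      intro x
      have : T x = t • x := rfl
      rw [this, real_inner_smul_left, mul_pow]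
    simp only [this]
    rw [integral_const_mul, ha θ hθ, ← hc, ht, ← Real.rpow_natCast, ← Real.rpow_mul hv.le,
      Real.rpow_add hv, Real.rpow_one]
    have : v ^ (-(1 / (n : ℝ)) * (2 : ℕ)) * v ^ (2 / (n : ℝ)) = 1 := by
      rw [← Real.rpow_add hv, show -(1 / (n : ℝ)) * (2 : ℕ) + 2 / (n : ℝ) = 0 by push_cast; ring,
        Real.rpow_zero]
    calc _ = v⁻¹ * v * c ^ 2 * (v ^ (-(1 / (n : ℝ)) * (2 : ℕ)) * v ^ (2 / (n : ℝ))) := by ring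
      _ = c ^ 2 := by rw [this, inv_mul_cancel₀ hv.ne']; ring

/-- The isotropic constant of a set in isotropic position. -/
theorem isotropicConstant_sq_mul_rpow (hn : 1 ≤ n) (hK : MeasurableSet K)
    (hv : 0 < volume.real K)
    (ha : ∀ θ : EuclideanSpace ℝ (Fin n), ‖θ‖ = 1 → ∫ x in K, inner ℝ x θ ^ 2 = a) :
    0 ≤ isotropicConstant K ∧ isotropicConstant K ^ 2 * volume.real K ^ (1 + 2 / (n : ℝ)) = a := by
  have ha0 : 0 ≤ a := by
    have : Nonempty (Fin n) := ⟨⟨0, hn⟩⟩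
    obtain ⟨θ, hθ⟩ : ∃ θ : EuclideanSpace ℝ (Fin n), ‖θ‖ = 1 := exists_norm_eq _ zero_le_one
    rw [← ha θ hθ]
    exact integral_nonneg fun x => sq_nonneg _
  set w := volume.real K ^ (1 + 2 / (n : ℝ)) with hw
  have hw0 : 0 < w := by positivity
  have h1 : √(a / w) ^ 2 * w = a := by
    rw [Real.sq_sqrt (by positivity), div_mul_cancel₀ _ hw0.ne']
  have : {c : ℝ | IsIsotropicValue K c} = {√(a / w)} := by
    ext c
    simp only [mem_ofPred_eq, mem_singleton_iff]
    constructor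
    · intro hc
      have h2 := hc.sq_mul_rpow hn hK ha
      rw [← hw] at h2
      rw [← h2, mul_div_cancel_right₀ _ hw0.ne', Real.sqrt_sq hc.1]
    · rintro rfl
      exact isIsotropicValue_of_sq_mul_rpow hn hK hv ha (Real.sqrt_nonneg _) h1
  rw [isotropicConstant, this, csSup_singleton]
  exact ⟨Real.sqrt_nonneg _, h1⟩

end IsotropicConstant

/-- The final arithmetic for sections: `L, v` belong to `K`, `l, w` to Ball's body, and `s` is the
section volume. Eliminating `a` and raising to the power `k / 2` produces the factor `e^(k+2)`; the
powers are doubled to avoid the half-integer exponent. -/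
theorem pow_mul_mul_rpow_le_of_sq_mul_rpow {k n : ℕ} (hk : 1 ≤ k) {L v a s w l m : ℝ}
    (hv : 0 < v) (hs : 0 < s) (hw : 0 ≤ w) (hl : 0 ≤ l) (hlm : l ≤ m)
    (h₁ : L ^ 2 * v ^ (1 + 2 / (n : ℝ)) = a) (h₂ : l ^ 2 * w ^ (1 + 2 / (k : ℝ)) = a / s)
    (hwv : w ≤ Real.exp 2 / s * v) :
    L ^ k * s * v ^ ((k : ℝ) / n) ≤ (Real.exp 3 * m) ^ k * v := by
  have hk0 : (0 : ℝ) < k := by exact_mod_cast hk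
  have hm : 0 ≤ m := hl.trans hlm
  set t := v ^ ((k : ℝ) / n) with ht
  have ht0 : 0 < t := by positivity
  have h3 : L ^ 2 * v ^ (1 + 2 / (n : ℝ)) ≤ s * (m ^ 2 * (Real.exp 2 / s * v) ^ (1 + 2 / (k : ℝ))) := by
    rw [h₁, show a = s * (a / s) by field_simp, ← h₂]
    gcongr
  have h4 := pow_le_pow_left₀ (by positivity) h3 k
  have e1 : (v ^ (1 + 2 / (n : ℝ))) ^ k = v ^ k * t ^ 2 := by
    rw [ht, ← Real.rpow_natCast, ← Real.rpow_natCast, ← Real.rpow_natCast, ← Real.rpow_mul hv.le,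
      ← Real.rpow_mul hv.le, ← Real.rpow_add hv]
    congr 1
    push_cast
    ring
  have e2 : ∀ x : ℝ, 0 < x → (x ^ (1 + 2 / (k : ℝ))) ^ k = x ^ (k + 2) := by
    intro x hx
    rw [← Real.rpow_natCast, ← Real.rpow_natCast, ← Real.rpow_mul hx.le]
    congr 1
    push_cast
    field_simp
  rw [mul_pow, mul_pow, mul_pow, e1, e2 _ (by positivity), mul_pow, div_pow] at h4
  set x := Real.exp 1 with hx
  have hx1 : 1 ≤ x := Real.one_le_exp zero_le_one
  have hx2 : Real.exp 2 = x ^ 2 := by rw [hx, ← Real.exp_nat_mul]; norm_num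
  have hx3 : Real.exp 3 = x ^ 3 := by rw [hx, ← Real.exp_nat_mul]; norm_num
  have h5 : (L ^ k * s * t) ^ 2 ≤ (m ^ k * x ^ (k + 2) * v) ^ 2 := by
    have e3 : (L ^ k * s * t) ^ 2 = (L ^ 2) ^ k * (v ^ k * t ^ 2) * (s ^ 2 / v ^ k) := by
      field_simp
      rw [pow_right_comm]
    have e4 : s ^ k * ((m ^ 2) ^ k * (Real.exp 2 ^ (k + 2) / s ^ (k + 2) * v ^ (k + 2))) *
        (s ^ 2 / v ^ k) = (m ^ k * x ^ (k + 2) * v) ^ 2 := by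
      rw [pow_add s, pow_add v, hx2, mul_pow, mul_pow, pow_right_comm x, pow_right_comm m]
      field_simp
    rw [e3, ← e4]
    exact mul_le_mul_of_nonneg_right h4 (by positivity)
  -- Here `k ≥ 1` gives `k + 2 ≤ 3 * k`, which is the origin of the constant `e³`.
  refine (le_of_abs_le <| abs_le_of_sq_le_sq h5 (by positivity)).trans ?_
  rw [hx3, mul_pow, ← pow_mul, mul_comm (m ^ k)]
  gcongr
  omega

/-! ### Parallel sections of an isotropic body -/

theorem norm_le_norm_add_orthogonal {V : Type*} [NormedAddCommGroup V]
    [InnerProductSpace ℝ V] {k : ℕ} {E : Submodule ℝ V}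
    (e : EuclideanSpace ℝ (Fin k) ≃ₗᵢ[ℝ] Eᗮ) (y : EuclideanSpace ℝ (Fin k)) (z : E) :
    ‖y‖ ≤ ‖(e y : V) + z‖ ∧ ‖z‖ ≤ ‖(e y : V) + z‖ := by
  have h0 : inner ℝ (e y : V) (z : V) = 0 := Submodule.inner_left_of_mem_orthogonal z.2 (e y).2
  have h := norm_add_sq_real (e y : V) (z : V)
  rw [h0, mul_zero, add_zero] at h
  have h1 : ‖(e y : V)‖ = ‖y‖ := e.norm_map y
  have h2 : ‖(z : V)‖ = ‖z‖ := rfl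
  rw [h1, h2] at h
  constructor
  · refine (sq_le_sq₀ (norm_nonneg _) (norm_nonneg _)).1 (by nlinarith [sq_nonneg ‖z‖])
  · refine (sq_le_sq₀ (norm_nonneg _) (norm_nonneg _)).1 (by nlinarith [sq_nonneg ‖y‖])

section Fubini

variable {V : Type*} [NormedAddCommGroup V] [InnerProductSpace ℝ V] [FiniteDimensional ℝ V]
  [MeasurableSpace V] [BorelSpace V]

/-- The product decomposition of the volume along a subspace and its orthogonal complement. -/
theorem measurePreserving_add_orthogonal {k : ℕ} (E : Submodule ℝ V)
    (e : EuclideanSpace ℝ (Fin k) ≃ₗᵢ[ℝ] Eᗮ) :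
    MeasurePreserving (fun p : EuclideanSpace ℝ (Fin k) × E => (e p.1 : V) + p.2)
      (volume.prod volume) volume := by
  have h1 : MeasurePreserving (Prod.map e id) (volume.prod (volume : Measure E))
      ((volume : Measure Eᗮ).prod (volume : Measure E)) :=
    e.measurePreserving.prod (MeasurePreserving.id _)
  have h2 : MeasurePreserving Prod.swap ((volume : Measure Eᗮ).prod (volume : Measure E))
      (volume.prod volume) := Measure.measurePreserving_swap
  have h3 := (WithLp.volume_preserving_toLp E Eᗮ)
  have h4 := E.orthogonalDecomposition.symm.measurePreserving
  have h := h4.comp (h3.comp (h2.comp h1))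
  convert! h using 1
  ext p
  simp [add_comm]

/-- Fubini for an integrand depending only on the `Eᗮ` component; it transfers mass and covariance
from `K` to its section function. -/
theorem setLIntegral_eq_lintegral_mul_section {k : ℕ} {E : Submodule ℝ V}
    (e : EuclideanSpace ℝ (Fin k) ≃ₗᵢ[ℝ] Eᗮ) {K : Set V} (hK : MeasurableSet K)
    {f : EuclideanSpace ℝ (Fin k) → ℝ≥0∞} {F : V → ℝ≥0∞} (hF : Measurable F)
    (hfF : ∀ (y : EuclideanSpace ℝ (Fin k)) (z : E), F ((e y : V) + z) = f y) :
    ∫⁻ x in K, F x = ∫⁻ y, f y * volume {z : E | (e y : V) + z ∈ K} := by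
  have hΦ := measurePreserving_add_orthogonal E e
  rw [← lintegral_indicator hK, ← hΦ.lintegral_comp (hF.indicator hK), lintegral_prod]
  · refine lintegral_congr fun y => ?_
    have hm : MeasurableSet {z : E | (e y : V) + z ∈ K} :=
      hK.preimage ((continuous_const.add continuous_subtype_val).measurable)
    rw [← lintegral_indicator_one hm, ← lintegral_const_mul _ (measurable_one.indicator hm)]
    refine lintegral_congr fun z => ?_
    by_cases h : (e y : V) + z ∈ K
    · rw [indicator_of_mem h, indicator_of_mem (by exact h), hfF]; simp
    · rw [indicator_of_notMem h, indicator_of_notMem (by exact h)]; simp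
  · exact ((hF.indicator hK).comp hΦ.measurable).aemeasurable

theorem measurable_volume_section {k : ℕ} {E : Submodule ℝ V}
    (e : EuclideanSpace ℝ (Fin k) ≃ₗᵢ[ℝ] Eᗮ) {K : Set V} (hK : MeasurableSet K) :
    Measurable fun y => volume {z : E | (e y : V) + z ∈ K} :=
  measurable_measure_prodMk_left
    (hK.preimage (measurePreserving_add_orthogonal E e).measurable)

/-- The volumes of the parallel sections of a symmetric convex body. -/
theorem isSymmLogConcave_section {k : ℕ} {E : Submodule ℝ V}
    (e : EuclideanSpace ℝ (Fin k) ≃ₗᵢ[ℝ] Eᗮ) {K : Set V} (hconv : Convex ℝ K) (hK : IsCompact K)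
    (hsymm : -K = K) (hpos : 0 < volume.real {z : E | (z : V) ∈ K}) :
    (∀ y, volume {z : E | (e y : V) + z ∈ K} ≠ ∞) ∧
      IsSymmLogConcave fun y => volume.real {z : E | (e y : V) + z ∈ K} := by
  obtain ⟨R, hR⟩ := hK.isBounded.exists_norm_le
  have hm : ∀ y, MeasurableSet {z : E | (e y : V) + z ∈ K} := fun y =>
    hK.measurableSet.preimage ((continuous_const.add continuous_subtype_val).measurable)
  have hfin : ∀ y, volume {z : E | (e y : V) + z ∈ K} ≠ ∞ := by
    intro y
    refine (lt_of_le_of_lt (measure_mono fun z hz => ?_)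
      (measure_closedBall_lt_top (x := (0 : E)) (r := R))).ne
    rw [mem_closedBall_zero_iff]
    exact (norm_le_norm_add_orthogonal e y z).2.trans (hR _ hz)
  refine ⟨hfin, (measurable_volume_section e hK.measurableSet).ennreal_toReal,
    fun _ => measureReal_nonneg, fun y => ?_, fun x y a b ha hb hab => ?_,
    ⟨max R 1, by positivity, fun y hy => ?_⟩, by simpa using hpos⟩
  · have : {z : E | (e (-y) : V) + z ∈ K} = -{z : E | (e y : V) + z ∈ K} := by
      ext z
      rw [Set.mem_neg, mem_ofPred_eq, mem_ofPred_eq]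
      conv_lhs => rw [← hsymm, Set.mem_neg]
      simp [add_comm]
    rw [this, measureReal_def, measureReal_def, Measure.measure_neg]
  · have h := volume_rpow_mul_volume_rpow_le ha hb hab (hm x) (hm y) (hm (a • x + b • y))
      fun z hz w hw => by
        have := hconv hz hw ha.le hb.le hab
        simp only [mem_ofPred_eq] at this ⊢
        convert! this using 1
        simp only [map_add, map_smul, Submodule.coe_add, Submodule.coe_smul, smul_add]
        abel
    have := ENNReal.toReal_mono (hfin _) h
    rwa [ENNReal.toReal_mul, ← ENNReal.toReal_rpow, ← ENNReal.toReal_rpow] at this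
  · have : {z : E | (e y : V) + z ∈ K} = ∅ := by
      ext z
      simp only [mem_ofPred_eq, mem_empty_iff_false, iff_false]
      intro hz
      have := (norm_le_norm_add_orthogonal e y z).1.trans (hR _ hz)
      exact absurd hy (not_lt.2 (this.trans (le_max_left _ _)))
    simp [this]

end Fubini

theorem IsSymmConvexBody.measureReal_pos {n : ℕ} {K : Set (EuclideanSpace ℝ (Fin n))}
    (hK : IsSymmConvexBody K) : 0 < volume.real K := by
  refine ENNReal.toReal_pos ?_ hK.isCompact.measure_lt_top.ne
  exact (Measure.measure_pos_of_nonempty_interior _ hK.interior_nonempty).ne'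

/-- The volume of a section of an isotropic body is controlled by the isotropic constants. -/
theorem isotropicConstant_pow_mul_section_le {n k : ℕ} (hk : 1 ≤ k) (hkn : k < n)
    {K : Set (EuclideanSpace ℝ (Fin n))} (hK : IsSymmConvexBody K) (hiso : IsIsotropic K)
    {m : ℝ} (hm0 : 0 ≤ m) (hm : ∀ B : Set (EuclideanSpace ℝ (Fin k)), IsSymmConvexBody B →
      isotropicConstant B ≤ m)
    (E : Submodule ℝ (EuclideanSpace ℝ (Fin n))) (hE : Module.finrank ℝ E = n - k) :
    isotropicConstant K ^ k * volume.real {z : E | (z : EuclideanSpace ℝ (Fin n)) ∈ K} *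
      volume.real K ^ ((k : ℝ) / n) ≤ (Real.exp 3 * m) ^ k * volume.real K := by
  obtain ⟨a, ha⟩ := hiso
  have hKm := hK.isCompact.measurableSet
  have hv := hK.measureReal_pos
  obtain ⟨hL0, hL⟩ := isotropicConstant_sq_mul_rpow (by omega) hKm hv ha
  -- The degenerate cases are immediate. Discarding them gives `g 0 > 0` and `a > 0`, both needed to
  -- build Ball's body.
  rcases (measureReal_nonneg (μ := volume)
    (s := {z : E | (z : EuclideanSpace ℝ (Fin n)) ∈ K})).eq_or_lt with h0 | hs
  · rw [← h0]
    simp only [mul_zero, zero_mul]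
    positivity
  rcases hL0.eq_or_lt with h0 | hLpos
  · rw [← h0, zero_pow (by omega)]
    simp only [zero_mul]
    positivity
  have ha0 : 0 < a := by rw [← hL]; positivity
  have hF : Module.finrank ℝ Eᗮ = k := by
    have := E.finrank_add_finrank_orthogonal
    rw [hE, finrank_euclideanSpace_fin] at this
    omega
  let e : EuclideanSpace ℝ (Fin k) ≃ₗᵢ[ℝ] Eᗮ :=
    ((stdOrthonormalBasis ℝ Eᗮ).reindex (finCongr hF)).repr.symm
  obtain ⟨hfin, hg⟩ := isSymmLogConcave_section e hK.convex hK.isCompact hK.neg_eq hs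
  set g : EuclideanSpace ℝ (Fin k) → ℝ := fun y =>
    volume.real {z : E | (e y : EuclideanSpace ℝ (Fin n)) + z ∈ K} with hgdef
  have hg0 : g 0 = volume.real {z : E | (z : EuclideanSpace ℝ (Fin n)) ∈ K} := by simp [hgdef]
  have hgr : ∀ y, ENNReal.ofReal (g y) =
      volume {z : E | (e y : EuclideanSpace ℝ (Fin n)) + z ∈ K} := fun y =>
    ENNReal.ofReal_toReal (hfin y)
  have hmass : ∫⁻ y, ENNReal.ofReal (g y) = volume K := by
    have := setLIntegral_eq_lintegral_mul_section e hKm (f := fun _ => 1)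
      (F := fun _ => 1) measurable_const fun _ _ => rfl
    simp only [one_mul, setLIntegral_one] at this
    rw [this]
    exact lintegral_congr hgr
  -- For a unit vector `θ`, the second moment of `g` along `θ` is that of `K` along `e θ`, since `E`
  -- is orthogonal to `e θ`.
  obtain ⟨B, hB, hBint, hBvol⟩ := hg.exists_isotropic_body hk ha0 fun θ hθ => by
    have hθ' : ‖(e θ : EuclideanSpace ℝ (Fin n))‖ = 1 := (e.norm_map θ).trans hθ
    have h := setLIntegral_eq_lintegral_mul_section e hKm
      (f := fun y => ENNReal.ofReal (inner ℝ y θ ^ 2))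
      (F := fun x => ENNReal.ofReal (inner ℝ x (e θ : EuclideanSpace ℝ (Fin n)) ^ 2))
      (by fun_prop) fun y z => by
        have h0 : inner ℝ (z : EuclideanSpace ℝ (Fin n)) (e θ : EuclideanSpace ℝ (Fin n)) = 0 :=
          Submodule.inner_right_of_mem_orthogonal z.2 (e θ).2
        rw [inner_add_left, h0, add_zero, ← e.inner_map_map y θ]
        rfl
    rw [← ha _ hθ', ofReal_integral_eq_lintegral_ofReal _
      (Filter.Eventually.of_forall fun x => sq_nonneg _), h]
    · refine lintegral_congr fun y => ?_
      rw [ENNReal.ofReal_mul (sq_nonneg _), hgr]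
    · exact ContinuousOn.integrableOn_compact hK.isCompact (by fun_prop)
  have hw := hB.measureReal_pos
  obtain ⟨hl0, hl⟩ := isotropicConstant_sq_mul_rpow hk hB.isCompact.measurableSet hw hBint
  rw [hg0] at hl
  refine pow_mul_mul_rpow_le_of_sq_mul_rpow hk hv hs hw.le hl0 (hm B hB) hL hl ?_
  rw [hmass, hg0] at hBvol
  have := ENNReal.toReal_mono (ENNReal.mul_ne_top ENNReal.ofReal_ne_top
    hK.isCompact.measure_lt_top.ne) hBvol
  rwa [ENNReal.toReal_mul, ENNReal.toReal_ofReal (by positivity)] at this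

/-! ### Polar coordinates and volumes of unit balls -/

section Sphere

variable {F : Type*} [NormedAddCommGroup F] [InnerProductSpace ℝ F] [FiniteDimensional ℝ F]
  [MeasurableSpace F] [BorelSpace F] [Nontrivial F]

instance sphereProb.instIsProbabilityMeasure : IsProbabilityMeasure (sphereProb F) := by
  constructor
  rw [sphereProb, Measure.smul_apply, smul_eq_mul]
  refine ENNReal.inv_mul_cancel ?_ (measure_ne_top _ _)
  rw [Measure.measure_univ_ne_zero]
  exact Measure.toSphere_ne_zero _

/-- The reciprocal of the gauge is the radial function of `C`, and `d ∫₀^ρ r^(d-1) dr = ρ^d` in each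
direction. -/
theorem lintegral_gauge_inv_pow_toSphere {C : Set F} (hconv : Convex ℝ C) (hC : IsCompact C)
    (h0 : C ∈ nhds (0 : F)) :
    ∫⁻ u : sphere (0 : F) 1, ENNReal.ofReal ((gauge C u)⁻¹ ^ Module.finrank ℝ F)
      ∂(volume : Measure F).toSphere = Module.finrank ℝ F * volume C := by
  set d := Module.finrank ℝ F with hd
  have hd1 : 1 ≤ d := Module.finrank_pos
  rw [← lintegral_indicator_one hC.measurableSet,
    lintegral_eq_lintegral_sphere volume (measurable_one.indicator hC.measurableSet),
    ← lintegral_const_mul' _ _ (ENNReal.natCast_ne_top d)]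
  refine lintegral_congr fun u => ?_
  have hu : (u : F) ≠ 0 := ne_zero_of_mem_unit_sphere u
  have hg : 0 < gauge C (u : F) := (gauge_pos (absorbent_nhds_zero h0)
    ((NormedSpace.isVonNBounded_iff ℝ).2 hC.isBounded)).2 hu
  set ρ := (gauge C (u : F))⁻¹ with hρ
  have hρ0 : 0 < ρ := inv_pos.2 hg
  have hmem : ∀ r : ℝ, 0 < r → (r • (u : F) ∈ C ↔ r ≤ ρ) := by
    intro r hr
    rw [← hC.isClosed.closure_eq, ← gauge_le_one_iff_mem_closure hconv h0,
      gauge_smul_of_nonneg hr.le, smul_eq_mul, hρ, le_inv_comm₀ hr hg, ← one_div, le_div_iff₀ hr,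
      mul_comm]
  have : ∫⁻ r in Ioi (0 : ℝ), ENNReal.ofReal (r ^ (d - 1)) * C.indicator 1 (r • (u : F)) =
      ENNReal.ofReal (ρ ^ d / d) := by
    calc _ = ∫⁻ r in Ioi (0 : ℝ), (Ioc 0 ρ).indicator (fun r => ENNReal.ofReal (r ^ (d - 1))) r := by
          refine setLIntegral_congr_fun measurableSet_Ioi fun r hr => ?_
          by_cases h : r ≤ ρ
          · have hm : r ∈ Ioc 0 ρ := ⟨hr, h⟩
            simp [hm, (hmem r hr).2 h]
          · have hm : r ∉ Ioc 0 ρ := fun h' => h h'.2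
            simp [hm, mt (hmem r hr).1 h]
      _ = ∫⁻ r in Ioc 0 ρ, ENNReal.ofReal (r ^ (d - 1)) := by
          rw [lintegral_indicator measurableSet_Ioc, Measure.restrict_restrict measurableSet_Ioc,
            inter_eq_left.2 Ioc_subset_Ioi_self]
      _ = _ := by
          have e : ((d - 1 : ℕ) : ℝ) + 1 = d := by exact_mod_cast Nat.sub_add_cancel hd1
          rw [← ofReal_integral_eq_lintegral_ofReal, ← intervalIntegral.integral_of_le hρ0.le,
            integral_pow, e, Nat.sub_add_cancel hd1, zero_pow (by omega), sub_zero]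
          · exact (continuous_pow _).integrableOn_Ioc
          · filter_upwards [ae_restrict_mem measurableSet_Ioc] with r hr
            exact pow_nonneg hr.1.le _
  rw [this, ← ENNReal.ofReal_natCast, ← ENNReal.ofReal_mul (by positivity)]
  congr 1
  field_simp

/-- The volume of a convex body in polar coordinates. -/
theorem integral_gauge_inv_pow_sphereProb {C : Set F} (hconv : Convex ℝ C) (hC : IsCompact C)
    (h0 : C ∈ nhds (0 : F)) :
    ∫ u : sphere (0 : F) 1, (gauge C u)⁻¹ ^ Module.finrank ℝ F ∂(sphereProb F) =
      volume.real C / volume.real (ball (0 : F) 1) := by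
  have hcont : Continuous fun u : sphere (0 : F) 1 => gauge C (u : F) :=
    (continuous_gauge hconv h0).comp continuous_subtype_val
  rw [integral_eq_lintegral_of_nonneg_ae
    (Filter.Eventually.of_forall fun u => pow_nonneg (inv_nonneg.2 (gauge_nonneg _)) _)
    (hcont.measurable.inv.pow_const _).aestronglyMeasurable, sphereProb, lintegral_smul_measure,
    lintegral_gauge_inv_pow_toSphere hconv hC h0, Measure.toSphere_apply_univ, smul_eq_mul,
    ENNReal.toReal_mul, ENNReal.toReal_inv, ENNReal.toReal_mul, ENNReal.toReal_mul]
  have hd : ((Module.finrank ℝ F : ℝ≥0∞)).toReal ≠ 0 := by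
    have : 0 < Module.finrank ℝ F := Module.finrank_pos
    simp [this.ne']
  rw [measureReal_def, measureReal_def, mul_inv, div_eq_mul_inv]
  field_simp

theorem volumeReal_ball_zero_one : volume.real (ball (0 : F) 1) =
    √Real.pi ^ Module.finrank ℝ F / Real.Gamma ((Module.finrank ℝ F : ℝ) / 2 + 1) := by
  rw [measureReal_def, InnerProductSpace.volume_ball, ENNReal.ofReal_one, one_pow, one_mul,
    ENNReal.toReal_ofReal]
  have : 0 < Real.Gamma ((Module.finrank ℝ F : ℝ) / 2 + 1) := Real.Gamma_pos_of_pos (by positivity)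
  positivity

end Sphere

theorem gauge_preimage_subtype {V : Type*} [AddCommGroup V] [Module ℝ V] (E : Submodule ℝ V)
    (K : Set V) (z : E) : gauge {z : E | (z : V) ∈ K} z = gauge K (z : V) := by
  simp only [gauge_def', mem_ofPred_eq, Submodule.coe_smul]

/-- Comparison of the volumes of unit balls of different dimensions. -/
theorem unitBallVolume_le {n k : ℕ} (hk : 1 ≤ k) (hkn : k < n) :
    √Real.pi ^ n / Real.Gamma ((n : ℝ) / 2 + 1) ≤
      √Real.pi ^ (n - k) / Real.Gamma (((n - k : ℕ) : ℝ) / 2 + 1) *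
        (√Real.pi ^ n / Real.Gamma ((n : ℝ) / 2 + 1)) ^ ((k : ℝ) / n) := by
  have hk0 : (0 : ℝ) < k := by exact_mod_cast hk
  have hkn' : (k : ℝ) < n := by exact_mod_cast hkn
  have hn0 : (0 : ℝ) < n := hk0.trans hkn'
  have hc : ((n - k : ℕ) : ℝ) = n - k := by push_cast [hkn.le]; ring
  set G := Real.Gamma ((n : ℝ) / 2 + 1) with hG
  have hG0 : 0 < G := Real.Gamma_pos_of_pos (by positivity)
  have hH0 : 0 < Real.Gamma (((n - k : ℕ) : ℝ) / 2 + 1) := Real.Gamma_pos_of_pos (by positivity)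
  have hpi : 0 < √Real.pi := by positivity
  -- Log-convexity of Gamma between `1` and `n / 2 + 1`, with weights chosen to reach `(n - k) / 2 +
  -- 1`. The value `Γ(1) = 1` drops out, and the powers of `π` match exactly.
  have hconv := Real.Gamma_mul_add_mul_le_rpow_Gamma_mul_rpow_Gamma (s := 1) (t := (n : ℝ) / 2 + 1)
    (a := (k : ℝ) / n) (b := 1 - (k : ℝ) / n) one_pos (by positivity) (by positivity)
    (by rw [sub_pos, div_lt_one hn0]; exact hkn') (by ring)
  rw [Real.Gamma_one, Real.one_rpow, one_mul, ← hG,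
    show (k : ℝ) / n * 1 + (1 - (k : ℝ) / n) * ((n : ℝ) / 2 + 1) = ((n - k : ℕ) : ℝ) / 2 + 1 by
      rw [hc]; field_simp; ring] at hconv
  have hGG : Real.Gamma (((n - k : ℕ) : ℝ) / 2 + 1) * G ^ ((k : ℝ) / n) ≤ G := by
    calc _ ≤ G ^ (1 - (k : ℝ) / n) * G ^ ((k : ℝ) / n) := by gcongr
      _ = G := by rw [← Real.rpow_add hG0, sub_add_cancel, Real.rpow_one]
  have hp : (√Real.pi ^ n) ^ ((k : ℝ) / n) = √Real.pi ^ k := by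
    rw [← Real.rpow_natCast, ← Real.rpow_mul hpi.le, mul_div_cancel₀ _ hn0.ne', Real.rpow_natCast]
  rw [Real.div_rpow (by positivity) hG0.le, hp, div_mul_div_comm, ← pow_add,
    Nat.sub_add_cancel hkn.le]
  gcongr

theorem IsSymmConvexBody.mem_nhds_zero {n : ℕ} {K : Set (EuclideanSpace ℝ (Fin n))}
    (hK : IsSymmConvexBody K) : K ∈ nhds 0 := by
  obtain ⟨x, hx⟩ := hK.interior_nonempty
  have hx' : -x ∈ interior K := by
    have h := (Homeomorph.neg (EuclideanSpace ℝ (Fin n))).preimage_interior K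
    simp only [Homeomorph.coe_neg, neg_preimage, hK.neg_eq] at h
    rw [← h]
    simpa using hx
  have := hK.convex.interior hx hx' (a := 1 / 2) (b := 1 / 2) (by norm_num) (by norm_num)
    (by norm_num)
  rw [smul_neg, add_neg_cancel] at this
  exact mem_interior_iff_mem_nhds.1 this

/-! ### Radon transforms and the main estimate -/

/-- The spherical Radon transform of a power of the radial function computes volumes of sections. -/
theorem sphericalRadon_gauge_inv_pow {n m : ℕ} (hm : 1 ≤ m) {K : Set (EuclideanSpace ℝ (Fin n))}
    (hK : IsSymmConvexBody K) (f : C(sphere (0 : EuclideanSpace ℝ (Fin n)) 1, ℝ))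
    (hf : ∀ u, f u = (gauge K (u : EuclideanSpace ℝ (Fin n)))⁻¹ ^ m) (E : Grassmann n m) :
    sphericalRadon m f E = volume.real {z : E.1 | (z : EuclideanSpace ℝ (Fin n)) ∈ K} /
      (√Real.pi ^ m / Real.Gamma ((m : ℝ) / 2 + 1)) := by
  have hE := E.2
  have : Nontrivial E.1 := Module.nontrivial_of_finrank_pos (R := ℝ) (by rw [hE]; omega)
  have hconv : Convex ℝ {z : E.1 | (z : EuclideanSpace ℝ (Fin n)) ∈ K} :=
    hK.convex.linear_preimage E.1.subtype
  have hcomp : IsCompact {z : E.1 | (z : EuclideanSpace ℝ (Fin n)) ∈ K} :=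
    (Submodule.closed_of_finiteDimensional E.1).isClosedEmbedding_subtypeVal.isCompact_preimage
      hK.isCompact
  have hnhds : {z : E.1 | (z : EuclideanSpace ℝ (Fin n)) ∈ K} ∈ nhds (0 : E.1) :=
    continuous_subtype_val.continuousAt.preimage_mem_nhds hK.mem_nhds_zero
  have h := integral_gauge_inv_pow_sphereProb hconv hcomp hnhds
  rw [volumeReal_ball_zero_one] at h
  simp only [hE, gauge_preimage_subtype] at h
  rw [← h, sphericalRadon]
  simp only [hf]
  rfl

theorem sphericalRadon_one {n m : ℕ} (hm : 1 ≤ m) (E : Grassmann n m) :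
    sphericalRadon m 1 E = 1 := by
  have hE := E.2
  have : Nontrivial E.1 := Module.nontrivial_of_finrank_pos (R := ℝ) (by rw [hE]; omega)
  simp [sphericalRadon]

/-- Averages the section bound against `μ`. Positivity of the mean radius is recorded for the case
in which the maximal isotropic constant is infinite. -/
theorem IsBusemannPetty.isotropicConstant_le {n k : ℕ} (hk : 1 ≤ k) (hkn : k < n)
    {K L : Set (EuclideanSpace ℝ (Fin n))} (hK : IsSymmConvexBody K) (hiso : IsIsotropic K)
    (hvol : volume K = volume (closedBall (0 : EuclideanSpace ℝ (Fin n)) 1))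
    (hL : IsBusemannPetty k L) (hKL : K ⊆ L) :
    0 < meanRadius k L ∧ ∀ m : ℝ, (∀ B : Set (EuclideanSpace ℝ (Fin k)), IsSymmConvexBody B →
      isotropicConstant B ≤ m) → 0 ≤ m →
      isotropicConstant K ≤ Real.exp 3 * (m * meanRadius k L) := by
  obtain ⟨hstar, μ, hμ, hdual⟩ := hL
  have : Nonempty (Fin n) := ⟨⟨0, by omega⟩⟩
  have hn : Module.finrank ℝ (EuclideanSpace ℝ (Fin n)) = n := finrank_euclideanSpace_fin
  have hnhds := hK.mem_nhds_zero
  have hcg : Continuous fun u : sphere (0 : EuclideanSpace ℝ (Fin n)) 1 =>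
      gauge K (u : EuclideanSpace ℝ (Fin n)) :=
    (continuous_gauge hK.convex hnhds).comp continuous_subtype_val
  have hpos : ∀ u : sphere (0 : EuclideanSpace ℝ (Fin n)) 1,
      0 < gauge K (u : EuclideanSpace ℝ (Fin n)) := fun u =>
    (gauge_pos (absorbent_nhds_zero hnhds)
      ((NormedSpace.isVonNBounded_iff ℝ).2 hK.isCompact.isBounded)).2
      (ne_zero_of_mem_unit_sphere u)
  have hcinv : Continuous fun u : sphere (0 : EuclideanSpace ℝ (Fin n)) 1 =>
      (gauge K (u : EuclideanSpace ℝ (Fin n)))⁻¹ := hcg.inv₀ fun u => (hpos u).ne'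
  have hρ : ∀ u : sphere (0 : EuclideanSpace ℝ (Fin n)) 1,
      (gauge K (u : EuclideanSpace ℝ (Fin n)))⁻¹ ≤ radialFunction L u := by
    intro u
    refine (hstar.isGreatest u (mem_sphere_zero_iff_norm.1 u.2)).2 ⟨(inv_pos.2 (hpos u)).le, hKL ?_⟩
    have hcl := gauge_le_one_iff_mem_closure hK.convex hnhds
      (x := (gauge K (u : EuclideanSpace ℝ (Fin n)))⁻¹ • (u : EuclideanSpace ℝ (Fin n)))
    rw [hK.isCompact.isClosed.closure_eq] at hcl
    rw [← hcl, gauge_smul_of_nonneg (inv_pos.2 (hpos u)).le, smul_eq_mul, inv_mul_cancel₀ (hpos u).ne']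
  have hv := hK.measureReal_pos
  have hvball : volume.real (ball (0 : EuclideanSpace ℝ (Fin n)) 1) = volume.real K := by
    rw [measureReal_def, measureReal_def, hvol, Measure.addHaar_closedBall_eq_addHaar_ball]
  have hone : ∫ u : sphere (0 : EuclideanSpace ℝ (Fin n)) 1,
      (gauge K (u : EuclideanSpace ℝ (Fin n)))⁻¹ ^ n ∂(sphereProb _) = 1 := by
    have := integral_gauge_inv_pow_sphereProb hK.convex hK.isCompact hnhds
    rwa [hn, hvball, div_self hv.ne'] at this
  have hintegrable : ∀ {f : sphere (0 : EuclideanSpace ℝ (Fin n)) 1 → ℝ}, Continuous f →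
      Integrable f (sphereProb _) := fun hf =>
    hf.integrable_of_hasCompactSupport (HasCompactSupport.of_compactSpace _)
  let f : C(sphere (0 : EuclideanSpace ℝ (Fin n)) 1, ℝ) :=
    ⟨fun u => (gauge K (u : EuclideanSpace ℝ (Fin n)))⁻¹ ^ (n - k), hcinv.pow _⟩
  have hfR : 1 ≤ ∫ E, sphericalRadon (n - k) f E ∂μ := by
    rw [← hdual f]
    refine hone.symm.le.trans ?_
    refine integral_mono (hintegrable (hcinv.pow _))
      (hintegrable (f.continuous.mul (hstar.continuous_radial.pow k))) fun u => ?_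
    have h0 := (inv_pos.2 (hpos u)).le
    calc (gauge K (u : EuclideanSpace ℝ (Fin n)))⁻¹ ^ n =
        (gauge K (u : EuclideanSpace ℝ (Fin n)))⁻¹ ^ (n - k) *
          (gauge K (u : EuclideanSpace ℝ (Fin n)))⁻¹ ^ k := by
            rw [← pow_add, Nat.sub_add_cancel hkn.le]
      _ ≤ _ := mul_le_mul_of_nonneg_left (pow_le_pow_left₀ h0 (hρ u) k) (pow_nonneg h0 _)
  set I := ∫ u : sphere (0 : EuclideanSpace ℝ (Fin n)) 1, radialFunction L u ^ k ∂(sphereProb _)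
    with hI
  have hIμ : I = μ.real univ := by
    have := hdual 1
    simp only [ContinuousMap.one_apply, one_mul, sphericalRadon_one (by omega : 1 ≤ n - k)] at this
    rw [hI, this]
    simp
  -- If `μ` vanished, the Radon integral in `hfR` would be `0` rather than at least `1`.
  have hI0 : 0 < I := by
    rw [hIμ]
    refine lt_of_le_of_ne measureReal_nonneg fun h => ?_
    have : μ = 0 := by
      rw [← Measure.measure_univ_eq_zero]
      exact (measureReal_eq_zero_iff (measure_ne_top _ _)).1 h.symm
    rw [this, integral_zero_measure] at hfR
    linarith
  have hMR0 : 0 < meanRadius k L := Real.rpow_pos_of_pos hI0 _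
  have hMRk : meanRadius k L ^ k = I := by
    rw [meanRadius, one_div]
    exact Real.rpow_inv_natCast_pow hI0.le (by omega)
  refine ⟨hMR0, fun m hm hm0 => ?_⟩
  have hsec : ∀ E : Grassmann n (n - k),
      -- The ball comparison gives `Vol(K) ≤ ω * Vol(K)^(k/n)`, because `K` has the volume of the
      -- unit ball. This removes every volume from the section bound.
      isotropicConstant K ^ k * sphericalRadon (n - k) f E ≤ (Real.exp 3 * m) ^ k := by
    intro E
    have h1 := isotropicConstant_pow_mul_section_le hk hkn hK hiso hm0 hm E.1 E.2
    rw [sphericalRadon_gauge_inv_pow (by omega) hK f (fun _ => rfl)]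
    have h2 := unitBallVolume_le hk hkn
    have h3 : volume.real K = √Real.pi ^ n / Real.Gamma ((n : ℝ) / 2 + 1) := by
      rw [← hvball, volumeReal_ball_zero_one, hn]
    rw [← h3] at h2
    set ω := √Real.pi ^ (n - k) / Real.Gamma (((n - k : ℕ) : ℝ) / 2 + 1)
    have hω : 0 < ω := by
      have : 0 < Real.Gamma (((n - k : ℕ) : ℝ) / 2 + 1) := Real.Gamma_pos_of_pos (by positivity)
      positivity
    have ht : 0 < volume.real K ^ ((k : ℝ) / n) := by positivity
    rw [mul_div_assoc', div_le_iff₀ hω]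
    refine le_of_mul_le_mul_right ?_ ht
    refine h1.trans ?_
    rw [mul_assoc]
    gcongr
  have hL0 : 0 ≤ isotropicConstant K := by
    obtain ⟨a, ha⟩ := hiso
    exact (isotropicConstant_sq_mul_rpow (by omega) hK.isCompact.measurableSet hv ha).1
  have hnn : ∀ E : Grassmann n (n - k), 0 ≤ sphericalRadon (n - k) f E := fun E =>
    integral_nonneg fun u => pow_nonneg (inv_nonneg.2 (gauge_nonneg _)) _
  have hfin : isotropicConstant K ^ k ≤ (Real.exp 3 * (m * meanRadius k L)) ^ k := by
    calc isotropicConstant K ^ k ≤ isotropicConstant K ^ k * ∫ E, sphericalRadon (n - k) f E ∂μ :=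
          le_mul_of_one_le_right (by positivity) hfR
      _ = ∫ E, isotropicConstant K ^ k * sphericalRadon (n - k) f E ∂μ :=
          (integral_const_mul _ _).symm
      _ ≤ ∫ _, (Real.exp 3 * m) ^ k ∂μ :=
          -- Only the constant bound has to be integrable, so no regularity of the Radon transform
          -- in `E` is required.
          integral_mono_of_nonneg
            (Filter.Eventually.of_forall fun E => mul_nonneg (pow_nonneg hL0 _) (hnn E))
            (integrable_const _) (Filter.Eventually.of_forall hsec)
      _ = _ := by
          rw [integral_const, ← hIμ, ← hMRk, smul_eq_mul, ← mul_pow]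
          ring
  exact (pow_le_pow_iff_left₀ hL0 (by positivity) (by omega)).1 hfin

theorem theorem2 :
    ∃ C : ℝ≥0, 0 < C ∧
      ∀ (n : ℕ) (K : Set (EuclideanSpace ℝ (Fin n))),
        IsSymmConvexBody K → IsIsotropic K →
        volume K = volume (closedBall (0 : EuclideanSpace ℝ (Fin n)) 1) →
        ENNReal.ofReal (isotropicConstant K) ≤
          (C : ℝ≥0∞) *
            ⨅ (k : ℕ) (_ : 1 ≤ k ∧ k < n) (L : Set (EuclideanSpace ℝ (Fin n)))
              (_ : IsBusemannPetty k L ∧ K ⊆ L),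
              maxIsotropicConstant k * ENNReal.ofReal (meanRadius k L) := by
  have hC : 0 < (Real.exp 3).toNNReal := by simpa using Real.exp_pos 3
  refine ⟨(Real.exp 3).toNNReal, hC, fun n K hK hiso hvol => ?_⟩
  have hC0 : ((Real.exp 3).toNNReal : ℝ≥0∞) ≠ 0 := by exact_mod_cast hC.ne'
  -- Moving the nonzero constant to the left isolates the infimum, which can then be bounded
  -- termwise, also when no `k` is admissible.
  rw [mul_comm, ← ENNReal.div_le_iff hC0 ENNReal.coe_ne_top]
  refine le_iInf fun k => le_iInf fun hk => le_iInf fun L => le_iInf fun hL => ?_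
  rw [ENNReal.div_le_iff hC0 ENNReal.coe_ne_top, mul_comm]
  obtain ⟨hMR, hmain⟩ := hL.1.isotropicConstant_le hk.1 hk.2 hK hiso hvol hL.2
  -- Positivity of the mean radius rules out the convention `∞ * 0 = 0`, so an infinite maximal
  -- constant makes the right side infinite.
  rcases eq_or_ne (maxIsotropicConstant k) ∞ with htop | htop
  · rw [htop, ENNReal.top_mul (by simpa using hMR), ENNReal.mul_top hC0]
    exact le_top
  · have := hmain (maxIsotropicConstant k).toReal (fun B hB => by
      rw [← ENNReal.ofReal_le_iff_le_toReal htop]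
      exact le_iSup₂_of_le B hB le_rfl) ENNReal.toReal_nonneg
    refine (ENNReal.ofReal_le_ofReal this).trans_eq ?_
    rw [ENNReal.ofReal_mul (Real.exp_pos 3).le, ENNReal.ofReal_mul ENNReal.toReal_nonneg,
      ENNReal.ofReal_toReal htop]
    rfl
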